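/- \textbf{Syntax.} A signature consists of countable sets of constant symbols, function symbols and relation symbols; each function symbol $f$ and relation symbol $R$ has an arity $\alpha(f),\alpha(R)\ge 1$. There are countably many variable symbols $v_1,v_2,\ldots$. Terms are built from variable symbols, constant symbols and function symbols; formulas are built from the atomic formulas $\mathsf F$, $\mathsf T$, $(t_1=t_2)$, $R(t_1,\ldots,t_{\alpha(R)})$ by $\neg,\wedge,\vee,\forall x,\exists x$. $\varphi(t)$ denotes the result of literally replacing the free occurrences of $x$ in $\varphi=\varphi(x)$ by $t$; $t$ is free for $x$ in $\varphi$ if no variable symbol of $t$ becomes bound in $\varphi(t)$. $\wedge$ and $\vee$ associate to the left. \textbf{Semantics.} A structure $\sigma$ has a non-empty domain $D$, an element of $D$ for each constant symbol, a partial function $D^{\alpha(f)}\rightharpoonup D$ for each $f$, and a subset of $D^{\alpha(R)}$ for each $R$. Given an assignment $\nu$ of elements of $D$ to the variable symbols, a term has a value or is undefined (a term with an undefined argument is undefined), and a formula has one of the truth values $\mathsf F<\mathsf U<\mathsf T$: an atomic formula $t_1=t_2$ or $R(t_1,\ldots)$ has the value $\mathsf U$ if some $t_i$ is undefined and its usual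 truth value otherwise; $\neg$ exchanges $\mathsf F$ and $\mathsf T$ and fixes $\mathsf U$; $\wedge,\vee$ are minimum and maximum (Kleene), and $\forall x,\exists x$ are minimum and maximum over all values of $x$ in $D$. Write $(\sigma,\nu)\models\varphi$ if $\varphi$ has the value $\mathsf T$. \textbf{Isdef-formulas.} Isdef-formulas $\lceil\mathcal F\rceil$ assign to each function symbol $f$ a formula $\lceil f\rceil$ whose free variables are among $v_1,\ldots,v_{\alpha(f)}$, such that every function symbol $g$ occurring in $\lceil f\rceil$ has $\lceil g\rceil$ equal to the formula $\mathsf T$. They are extended to terms and formulas by: $\lceil x\rceil=\lceil c\rceil=\mathsf T$ for variable and constant symbols; $\lceil f(t_1,\ldots,t_n)\rceil=\lceil t_1\rceil\wedge\cdots\wedge\lceil t_n\rceil\wedge\lceil f\rceil(t_1,\ldots,t_n)$, where bound variables of $\lceil f\rceil$ are renamed when necessary to avoid capture; $\lceil\mathsf F\rceil=\lceil\mathsf T\rceil=\mathsf T$; $\lceil t_1=t_2\rceil=\lceil t_1\rceil\wedge\lceil t_2\rceil$; $\lceil R(t_1,\ldots,t_n)\rceil=\lceil t_1\rceil\wedge\cdots\wedge\lceil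 t_n\rceil$; $\lceil\neg\varphi\rceil=\lceil\varphi\rceil$; $\lceil\varphi\wedge\psi\rceil=(\lceil\varphi\rceil\wedge\lceil\psi\rceil)\vee(\lceil\varphi\rceil\wedge\neg\varphi)\vee(\lceil\psi\rceil\wedge\neg\psi)$; $\lceil\varphi\vee\psi\rceil=(\lceil\varphi\rceil\wedge\lceil\psi\rceil)\vee(\lceil\varphi\rceil\wedge\varphi)\vee(\lceil\psi\rceil\wedge\psi)$; $\lceil\forall x\,\varphi\rceil=(\forall x\,\lceil\varphi\rceil)\vee\exists x\,(\lceil\varphi\rceil\wedge\neg\varphi)$; $\lceil\exists x\,\varphi\rceil=(\forall x\,\lceil\varphi\rceil)\vee\exists x\,(\lceil\varphi\rceil\wedge\varphi)$. For a set $\Gamma$ of formulas, a model of $(\lceil\mathcal F\rceil,\Gamma)$ is a pair $(\sigma,\nu)$ such that $(\sigma,\nu)\models\varphi$ for all $\varphi\in\Gamma$ and, for each $f$ and $d_1,\ldots,d_{\alpha(f)}\in D$, the formula $\lceil f\rceil$ has the value $\mathsf T$ at $(d_1,\ldots,d_{\alpha(f)})$ if and only if the function denoted by $f$ is defined there. $(\lceil\mathcal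 F\rceil,\Gamma)\models\varphi$ means that every model of $(\lceil\mathcal F\rceil,\Gamma)$ is a model of $\varphi$. \textbf{Proof system.} $\Gamma\vdash\varphi$, in full $(\lceil\mathcal F\rceil,\Gamma)\vdash\varphi$, is the least relation between sets of formulas and formulas that satisfies the following for all sets $\Gamma,\Delta$, formulas $\varphi,\psi,\chi$, terms $t,t'$ and variable symbols $x,y$. (P1) $\{\varphi\}\vdash\varphi$. (P2) If $\Gamma\vdash\varphi$ then $\Gamma\cup\Delta\vdash\varphi$. (P3) If $\Gamma\vdash\varphi$ and $\Gamma\cup\{\varphi\}\vdash\psi$ then $\Gamma\vdash\psi$. (C1) $\emptyset\vdash(\varphi\vee\neg\varphi)\vee\neg\lceil\varphi\rceil$. (C2) $\{\mathsf F\}\vdash\varphi$. (C3) $\{\varphi,\neg\varphi\}\vdash\mathsf F$. (D1) $\{\varphi\}\vdash\lceil\varphi\rceil$. ($\wedge$) $\{\varphi,\psi\}\vdash\varphi\wedge\psi$; $\{\varphi\wedge\psi\}\vdash\varphi$; $\{\varphi\wedge\psi\}\vdash\psi$. ($\vee$) $\{\varphi\}\vdash\varphi\vee\psi$; $\{\psi\}\vdash\varphi\vee\psi$;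 if $\Gamma\cup\{\varphi\}\vdash\chi$ and $\Gamma\cup\{\psi\}\vdash\chi$ then $\Gamma\cup\{\varphi\vee\psi\}\vdash\chi$. ($=$1) $\{\lceil t\rceil\}\vdash t=t$. ($=$2) If $t_i$ and $t_i'$ are free for $x_i$ in $\varphi(x_1,\ldots,x_n)$ then $\{t_i=t_i',\ \varphi(t_1,\ldots,t_i,\ldots,t_n)\}\vdash\varphi(t_1,\ldots,t_i',\ldots,t_n)$. ($\forall$E) If $t$ is free for $x$ in $\varphi$ then $\{\lceil t\rceil,\forall x\,\varphi\}\vdash\varphi(t)$. ($\forall$I) If $\Gamma\vdash\varphi$ and $x$ is not free in any formula of $\Gamma$ then $\Gamma\vdash\forall x\,\varphi$. ($\exists$I) If $t$ is free for $x$ in $\varphi$ then $\{\varphi(t)\}\vdash\exists x\,\varphi$. ($\exists$E) If $\Gamma\cup\{\varphi(y)\}\vdash\psi$ and $y$ occurs neither in $\Gamma$ nor in $\exists x\,\varphi$ nor in $\psi$, then $\Gamma\cup\{\exists x\,\varphi\}\vdash\psi$. \textbf{Theorem.} For every signature, all isdef-formulas $\lceil\mathcal F\rceil$ on it, and every (possibly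 infinite) set $\Gamma$ of formulas: if $(\lceil\mathcal F\rceil,\Gamma)\not\vdash\mathsf F$, then $(\lceil\mathcal F\rceil,\Gamma)$ has a model; and for every formula $\varphi$, if $(\lceil\mathcal F\rceil,\Gamma)\models\varphi$, then $(\lceil\mathcal F\rceil,\Gamma)\vdash\varphi$. -/

import Mathlib

namespace PartialLogic

/-! ### Syntax

The variable symbols are indexed by `ℕ`, starting from `0`; the argument places of a function or
relation symbol of arity `n` are indexed by `Fin n`. -/

/-- A signature: countable sets of constant, function and relation symbols; the arities of
function and relation symbols are positive. -/
structure Signature where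
  Const : Type
  Func : Type
  Rel : Type
  funcArity : Func → ℕ
  relArity : Rel → ℕ
  countable_const : Countable Const
  countable_func : Countable Func
  countable_rel : Countable Rel
  funcArity_pos : ∀ f, 0 < funcArity f
  relArity_pos : ∀ R, 0 < relArity R

/-- Terms. -/
inductive Term (L : Signature) : Type
  | var (n : ℕ) : Term L
  | const (c : L.Const) : Term L
  | func (f : L.Func) (ts : Fin (L.funcArity f) → Term L) : Term L

/-- Formulas. -/
inductive Formula (L : Signature) : Type
  | falsum : Formula L
  | verum : Formula L
  | eq (t₁ t₂ : Term L) : Formula L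
  | rel (R : L.Rel) (ts : Fin (L.relArity R) → Term L) : Formula L
  | neg (φ : Formula L) : Formula L
  | and (φ ψ : Formula L) : Formula L
  | or (φ ψ : Formula L) : Formula L
  | all (x : ℕ) (φ : Formula L) : Formula L
  | ex (x : ℕ) (φ : Formula L) : Formula L

variable {L : Signature}

/-- The variable symbols that occur in a term. -/
def Term.vars : Term L → Finset ℕ
  | .var n => {n}
  | .const _ => ∅
  | .func _ ts => Finset.univ.biUnion fun i => (ts i).vars

/-- The function symbols that occur in a term. -/
def Term.funcs : Term L → Set L.Func
  | .var _ => ∅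
  | .const _ => ∅
  | .func f ts => {f} ∪ ⋃ i, (ts i).funcs

/-- Simultaneous substitution of the terms `σ n` for the variables `n` in a term. -/
def Term.subst (σ : ℕ → Term L) : Term L → Term L
  | .var n => σ n
  | .const c => .const c
  | .func f ts => .func f fun i => (ts i).subst σ

namespace Formula

/-- The variable symbols that occur free in a formula. -/
def freeVars : Formula L → Finset ℕ
  | .falsum => ∅
  | .verum => ∅
  | .eq t₁ t₂ => t₁.vars ∪ t₂.vars
  | .rel _ ts => Finset.univ.biUnion fun i => (ts i).vars
  | .neg φ => φ.freeVars
  | .and φ ψ => φ.freeVars ∪ ψ.freeVars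
  | .or φ ψ => φ.freeVars ∪ ψ.freeVars
  | .all x φ => φ.freeVars.erase x
  | .ex x φ => φ.freeVars.erase x

/-- The variable symbols that occur, free or bound, in a formula. -/
def vars : Formula L → Finset ℕ
  | .falsum => ∅
  | .verum => ∅
  | .eq t₁ t₂ => t₁.vars ∪ t₂.vars
  | .rel _ ts => Finset.univ.biUnion fun i => (ts i).vars
  | .neg φ => φ.vars
  | .and φ ψ => φ.vars ∪ ψ.vars
  | .or φ ψ => φ.vars ∪ ψ.vars
  | .all x φ => insert x φ.vars
  | .ex x φ => insert x φ.vars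

/-- The function symbols that occur in a formula. -/
def funcs : Formula L → Set L.Func
  | .falsum => ∅
  | .verum => ∅
  | .eq t₁ t₂ => t₁.funcs ∪ t₂.funcs
  | .rel _ ts => ⋃ i, (ts i).funcs
  | .neg φ => φ.funcs
  | .and φ ψ => φ.funcs ∪ ψ.funcs
  | .or φ ψ => φ.funcs ∪ ψ.funcs
  | .all _ φ => φ.funcs
  | .ex _ φ => φ.funcs

/-- Literal simultaneous replacement of every free occurrence of each variable symbol `n` by the
term `σ n`. Nothing is renamed, so variables of the `σ n` may become bound. -/
def subst : (ℕ → Term L) → Formula L → Formula L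
  | _, .falsum => .falsum
  | _, .verum => .verum
  | σ, .eq t₁ t₂ => .eq (t₁.subst σ) (t₂.subst σ)
  | σ, .rel R ts => .rel R fun i => (ts i).subst σ
  | σ, .neg φ => .neg (φ.subst σ)
  | σ, .and φ ψ => .and (φ.subst σ) (ψ.subst σ)
  | σ, .or φ ψ => .or (φ.subst σ) (ψ.subst σ)
  | σ, .all x φ => .all x (φ.subst (Function.update σ x (.var x)))
  | σ, .ex x φ => .ex x (φ.subst (Function.update σ x (.var x)))

/-- `φ.inst x t` is `φ(t)`: every free occurrence of `x` in `φ` is literally replaced by `t`. -/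
def inst (φ : Formula L) (x : ℕ) (t : Term L) : Formula L :=
  φ.subst (Function.update Term.var x t)

/-- `t` is free for `x` in the given formula: when the free occurrences of `x` are replaced
by `t`, no variable symbol of `t` becomes bound. -/
def FreeFor (t : Term L) (x : ℕ) : Formula L → Prop
  | .falsum => True
  | .verum => True
  | .eq _ _ => True
  | .rel _ _ => True
  | .neg φ => FreeFor t x φ
  | .and φ ψ => FreeFor t x φ ∧ FreeFor t x ψ
  | .or φ ψ => FreeFor t x φ ∧ FreeFor t x ψ
  | .all y φ => x ∈ φ.freeVars.erase y → y ∉ t.vars ∧ FreeFor t x φ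
  | .ex y φ => x ∈ φ.freeVars.erase y → y ∉ t.vars ∧ FreeFor t x φ

open Classical in
/-- The name given to the variable bound by a quantifier `Q x` with scope `φ` when `σ` is
substituted into `Q x φ`: it remains `x` unless `x` occurs in a term that is substituted for a free
variable of `Q x φ`; in that case it is a variable symbol that occurs neither in those terms nor in
`Q x φ`. -/
noncomputable def boundName (σ : ℕ → Term L) (x : ℕ) (φ : Formula L) : ℕ :=
  if ∀ y ∈ φ.freeVars.erase x, x ∉ (σ y).vars then x
  else ((insert x φ.vars) ∪ (φ.freeVars.erase x).biUnion fun y => (σ y).vars).sup id + 1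

/-- Simultaneous substitution where bound variables are renamed when this is necessary to prevent
variables of the substituted terms from becoming bound. -/
noncomputable def renSubst : (ℕ → Term L) → Formula L → Formula L
  | _, .falsum => .falsum
  | _, .verum => .verum
  | σ, .eq t₁ t₂ => .eq (t₁.subst σ) (t₂.subst σ)
  | σ, .rel R ts => .rel R fun i => (ts i).subst σ
  | σ, .neg φ => .neg (φ.renSubst σ)
  | σ, .and φ ψ => .and (φ.renSubst σ) (ψ.renSubst σ)
  | σ, .or φ ψ => .or (φ.renSubst σ) (ψ.renSubst σ)
  | σ, .all x φ =>
      .all (boundName σ x φ) (φ.renSubst (Function.update σ x (.var (boundName σ x φ))))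
  | σ, .ex x φ =>
      .ex (boundName σ x φ) (φ.renSubst (Function.update σ x (.var (boundName σ x φ))))

/-- The conjunction `φ₁ ∧ ⋯ ∧ φₙ`, associated to the left (it is only used with `n ≥ 1`). -/
def conj : List (Formula L) → Formula L
  | [] => .verum
  | φ :: l => l.foldl .and φ

end Formula

/-! ### Semantics -/

/-- A structure: a non-empty domain, elements for the constant symbols, partial functions for the
function symbols, and relations for the relation symbols. -/
structure Structure (L : Signature) where
  D : Type
  nonempty : Nonempty D
  const : L.Const → D
  func : (f : L.Func) → (Fin (L.funcArity f) → D) →. D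
  rel : (R : L.Rel) → Set (Fin (L.relArity R) → D)

/-- The truth values false, undefined, true. -/
inductive TV : Type
  | F : TV
  | U : TV
  | T : TV

namespace TV

/-- Negation of truth values. -/
def neg : TV → TV
  | F => T
  | U => U
  | T => F

/-- Kleene's conjunction. -/
def and : TV → TV → TV
  | T, T => T
  | F, _ => F
  | _, F => F
  | _, _ => U

/-- Kleene's disjunction. -/
def or : TV → TV → TV
  | F, F => F
  | T, _ => T
  | _, T => T
  | _, _ => U

open Classical in
/-- Kleene's universal quantifier. -/
noncomputable def all {D : Type} (v : D → TV) : TV :=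
  if ∀ d, v d = T then T else if ∃ d, v d = F then F else U

open Classical in
/-- Kleene's existential quantifier. -/
noncomputable def ex {D : Type} (v : D → TV) : TV :=
  if ∀ d, v d = F then F else if ∃ d, v d = T then T else U

end TV

open Classical in
/-- The truth value of the equality of two possibly undefined values. -/
noncomputable def TV.eqVal {D : Type} (p q : Part D) : TV :=
  if h : p.Dom ∧ q.Dom then if p.get h.1 = q.get h.2 then .T else .F else .U

open Classical in
/-- The truth value of the statement that a possibly undefined value belongs to `A`. -/
noncomputable def TV.memVal {D : Type} (p : Part D) (A : Set D) : TV :=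
  if h : p.Dom then if p.get h ∈ A then .T else .F else .U

/-- The tuple of possibly undefined values; it is defined if and only if all of them are. -/
def tuple {D : Type} {n : ℕ} (p : Fin n → Part D) : Part (Fin n → D) :=
  ⟨∀ i, (p i).Dom, fun h i => (p i).get (h i)⟩

/-- The value of a term under an assignment, if defined. A compound term is undefined if an
argument is undefined. -/
def Term.eval (M : Structure L) (ν : ℕ → M.D) : Term L → Part M.D
  | .var n => Part.some (ν n)
  | .const c => Part.some (M.const c)
  | .func f ts => (tuple fun i => (ts i).eval M ν).bind (M.func f)

/-- The truth value of a formula under an assignment. -/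
noncomputable def Formula.eval (M : Structure L) : (ℕ → M.D) → Formula L → TV
  | _, .falsum => .F
  | _, .verum => .T
  | ν, .eq t₁ t₂ => TV.eqVal (t₁.eval M ν) (t₂.eval M ν)
  | ν, .rel R ts => TV.memVal (tuple fun i => (ts i).eval M ν) (M.rel R)
  | ν, .neg φ => (φ.eval M ν).neg
  | ν, .and φ ψ => (φ.eval M ν).and (ψ.eval M ν)
  | ν, .or φ ψ => (φ.eval M ν).or (ψ.eval M ν)
  | ν, .all x φ => TV.all fun d => φ.eval M (Function.update ν x d)
  | ν, .ex x φ => TV.ex fun d => φ.eval M (Function.update ν x d)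

/-! ### Isdef-formulas -/

/-- Isdef-formulas on a signature: to each function symbol `f` a formula is assigned whose free
variables are among the first `α(f)` variable symbols (which stand for the arguments of `f`), and
that contains only function symbols whose isdef-formula is literally `verum`. -/
structure IsdefFormulas (L : Signature) where
  isdef : L.Func → Formula L
  freeVars_lt : ∀ f, ∀ n ∈ (isdef f).freeVars, n < L.funcArity f
  funcs_total : ∀ f, ∀ g ∈ (isdef f).funcs, isdef g = .verum

/-- The substitution that puts `ts i` in the place of the `i`-th variable symbol. -/
def argSubst {n : ℕ} (ts : Fin n → Term L) : ℕ → Term L := fun k =>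
  if h : k < n then ts ⟨k, h⟩ else .var k

/-- The formula expressing that a term is defined. -/
noncomputable def Term.isdef (δ : IsdefFormulas L) : Term L → Formula L
  | .var _ => .verum
  | .const _ => .verum
  | .func f ts =>
      Formula.conj ((List.ofFn fun i => (ts i).isdef δ) ++ [(δ.isdef f).renSubst (argSubst ts)])

/-- The formula expressing that a formula is defined. -/
noncomputable def Formula.isdef (δ : IsdefFormulas L) : Formula L → Formula L
  | .falsum => .verum
  | .verum => .verum
  | .eq t₁ t₂ => .and (t₁.isdef δ) (t₂.isdef δ)
  | .rel _ ts => Formula.conj (List.ofFn fun i => (ts i).isdef δ)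
  | .neg φ => φ.isdef δ
  | .and φ ψ =>
      .or (.or (.and (φ.isdef δ) (ψ.isdef δ)) (.and (φ.isdef δ) (.neg φ)))
        (.and (ψ.isdef δ) (.neg ψ))
  | .or φ ψ =>
      .or (.or (.and (φ.isdef δ) (ψ.isdef δ)) (.and (φ.isdef δ) φ)) (.and (ψ.isdef δ) ψ)
  | .all x φ => .or (.all x (φ.isdef δ)) (.ex x (.and (φ.isdef δ) (.neg φ)))
  | .ex x φ => .or (.all x (φ.isdef δ)) (.ex x (.and (φ.isdef δ) φ))

/-- `M` is a model of the isdef-formulas: each function is defined precisely at those arguments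
where its isdef-formula yields true. -/
def Structure.ModelsIsdef (M : Structure L) (δ : IsdefFormulas L) : Prop :=
  ∀ (f : L.Func) (ν : ℕ → M.D),
    (δ.isdef f).eval M ν = .T ↔ (M.func f fun i => ν i).Dom

/-- `(M, ν)` is a model of the pair consisting of the isdef-formulas `δ` and the set `Γ`. -/
def IsModel (δ : IsdefFormulas L) (Γ : Set (Formula L)) (M : Structure L) (ν : ℕ → M.D) : Prop :=
  M.ModelsIsdef δ ∧ ∀ φ ∈ Γ, φ.eval M ν = .T

/-- Logical consequence. -/
def Entails (δ : IsdefFormulas L) (Γ : Set (Formula L)) (φ : Formula L) : Prop :=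
  ∀ (M : Structure L) (ν : ℕ → M.D), IsModel δ Γ M ν → φ.eval M ν = .T

/-! ### The proof system -/

/-- `Proves δ Γ φ`: the formula `φ` can be proven from the isdef-formulas `δ` and the set `Γ`. -/
inductive Proves (δ : IsdefFormulas L) : Set (Formula L) → Formula L → Prop
  | P1 (φ : Formula L) : Proves δ {φ} φ
  | P2 (Γ Δ : Set (Formula L)) (φ : Formula L) : Proves δ Γ φ → Proves δ (Γ ∪ Δ) φ
  | P3 (Γ : Set (Formula L)) (φ ψ : Formula L) :
      Proves δ Γ φ → Proves δ (Γ ∪ {φ}) ψ → Proves δ Γ ψ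
  | C1 (φ : Formula L) : Proves δ ∅ (.or (.or φ (.neg φ)) (.neg (φ.isdef δ)))
  | C2 (φ : Formula L) : Proves δ {.falsum} φ
  | C3 (φ : Formula L) : Proves δ {φ, .neg φ} .falsum
  | D1 (φ : Formula L) : Proves δ {φ} (φ.isdef δ)
  | andI (φ ψ : Formula L) : Proves δ {φ, ψ} (.and φ ψ)
  | andE1 (φ ψ : Formula L) : Proves δ {.and φ ψ} φ
  | andE2 (φ ψ : Formula L) : Proves δ {.and φ ψ} ψ
  | orI1 (φ ψ : Formula L) : Proves δ {φ} (.or φ ψ)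
  | orI2 (φ ψ : Formula L) : Proves δ {ψ} (.or φ ψ)
  | orE (Γ : Set (Formula L)) (φ ψ χ : Formula L) :
      Proves δ (Γ ∪ {φ}) χ → Proves δ (Γ ∪ {ψ}) χ → Proves δ (Γ ∪ {.or φ ψ}) χ
  | eq1 (t : Term L) : Proves δ {t.isdef δ} (.eq t t)
  | eq2 (φ : Formula L) (σ : ℕ → Term L) (i : ℕ) (t t' : Term L) :
      φ.FreeFor t i → φ.FreeFor t' i →
      Proves δ {.eq t t', φ.subst (Function.update σ i t)} (φ.subst (Function.update σ i t'))
  | allE (φ : Formula L) (x : ℕ) (t : Term L) :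
      φ.FreeFor t x → Proves δ {t.isdef δ, .all x φ} (φ.inst x t)
  | allI (Γ : Set (Formula L)) (φ : Formula L) (x : ℕ) :
      Proves δ Γ φ → (∀ ψ ∈ Γ, x ∉ ψ.freeVars) → Proves δ Γ (.all x φ)
  | exI (φ : Formula L) (x : ℕ) (t : Term L) :
      φ.FreeFor t x → Proves δ {φ.inst x t} (.ex x φ)
  | exE (Γ : Set (Formula L)) (φ ψ : Formula L) (x y : ℕ) :
      Proves δ (Γ ∪ {φ.inst x (.var y)}) ψ →
      (∀ χ ∈ Γ, y ∉ χ.vars) → y ∉ (Formula.ex x φ).vars → y ∉ ψ.vars →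
      Proves δ (Γ ∪ {.ex x φ}) ψ

end PartialLogic

namespace PartialLogic

variable {L : Signature}

/-! ### Syntactic facts -/

/-! This is a Henkin argument in which variable symbols play the role of new constants. Suppose
first that Γ is consistent and leaves infinitely many variables unused. Then Γ extends to a maximal
consistent set T with witness variables for its existential formulas (`exists_isHenkin`). Excluded
middle is not available: by C1, T contains one of φ, ¬φ, ¬⌈φ⌉, which correspond to true, false and
undefined. The clauses defining ⌈φ⌉ say exactly when a Kleene connective or quantifier takes a
classical value, so membership of φ and of ¬φ in T follows the Kleene tables for the values T and F.

The variables modulo provable equality form a structure in which f is defined at a tuple of classes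
when T contains f(…) = z for some variable z. By induction on depth, φ is true there iff φ ∈ T, and
false iff ¬φ ∈ T (`IsHenkin.eval_canonical`); applied to ⌈f⌉, this shows that the functions have the
prescribed domains. Since replacement is literal, witnesses must be available outside any finite set
of variables; and since ⌈φ(y)⌉ and ⌈φ⌉(y) may name bound variables differently, passage from φ(y) to
⌈φ⌉(y) goes through `Proves.inst_var`.

A general Γ may use every variable. Renaming n to 2n frees the odd ones. That the renamed set is
still consistent is seen semantically: a refutation uses finitely many formulas, their originals
have a model by the first case, and soundness (`Proves.sound`) excludes the refutation.

Completeness for consequences follows: if Γ ⊨ φ, then neither Γ ∪ {¬φ} nor Γ ∪ {¬⌈φ⌉} has a model,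
so both prove everything, and C1 yields φ. -/

theorem Term.subst_congr {σ τ : ℕ → Term L} (t : Term L) (h : ∀ n ∈ t.vars, σ n = τ n) :
    t.subst σ = t.subst τ := by
  induction t with
  | var n => exact h n (by simp [Term.vars])
  | const c => rfl
  | func f ts ih =>
    simp only [Term.subst, Term.func.injEq, heq_eq_eq, true_and]
    funext i
    exact ih i fun n hn => h n (by simp only [Term.vars, Finset.mem_biUnion]; exact ⟨i, by simp, hn⟩)

theorem Term.subst_var (t : Term L) : t.subst Term.var = t := by
  induction t with
  | var n => rfl
  | const c => rfl
  | func f ts ih => simp only [Term.subst, ih]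

theorem Term.exists_of_mem_vars_subst {σ : ℕ → Term L} {n : ℕ} (t : Term L)
    (h : n ∈ (t.subst σ).vars) : ∃ m ∈ t.vars, n ∈ (σ m).vars := by
  induction t with
  | var m => exact ⟨m, by simp [Term.vars], h⟩
  | const c => simp [Term.subst, Term.vars] at h
  | func f ts ih =>
    simp only [Term.subst, Term.vars, Finset.mem_biUnion, Finset.mem_univ, true_and] at h ⊢
    obtain ⟨i, hi⟩ := h
    obtain ⟨m, hm, hn⟩ := ih i hi
    exact ⟨m, ⟨i, hm⟩, hn⟩

namespace Formula

theorem subst_congr {σ τ : ℕ → Term L} (φ : Formula L) (h : ∀ n ∈ φ.freeVars, σ n = τ n) :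
    φ.subst σ = φ.subst τ := by
  induction φ generalizing σ τ with
  | falsum => rfl
  | verum => rfl
  | eq t₁ t₂ =>
    simp only [freeVars, Finset.mem_union] at h
    simp only [subst, t₁.subst_congr fun n hn => h n (.inl hn),
      t₂.subst_congr fun n hn => h n (.inr hn)]
  | rel R ts =>
    simp only [subst, rel.injEq, heq_eq_eq, true_and]
    funext i
    exact (ts i).subst_congr fun n hn => h n (by
      simp only [freeVars, Finset.mem_biUnion]; exact ⟨i, by simp, hn⟩)
  | neg φ ih => simp only [subst, ih h]
  | and φ ψ ih₁ ih₂ =>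
    simp only [freeVars, Finset.mem_union] at h
    simp only [subst, ih₁ fun n hn => h n (.inl hn), ih₂ fun n hn => h n (.inr hn)]
  | or φ ψ ih₁ ih₂ =>
    simp only [freeVars, Finset.mem_union] at h
    simp only [subst, ih₁ fun n hn => h n (.inl hn), ih₂ fun n hn => h n (.inr hn)]
  | all x φ ih =>
    simp only [subst, all.injEq, true_and]
    refine ih fun n hn => ?_
    by_cases hx : n = x
    · simp [hx]
    · simp only [Function.update_of_ne hx]
      exact h n (Finset.mem_erase.2 ⟨hx, hn⟩)
  | ex x φ ih =>
    simp only [subst, ex.injEq, true_and]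
    refine ih fun n hn => ?_
    by_cases hx : n = x
    · simp [hx]
    · simp only [Function.update_of_ne hx]
      exact h n (Finset.mem_erase.2 ⟨hx, hn⟩)

theorem subst_var (φ : Formula L) : φ.subst Term.var = φ := by
  induction φ with
  | falsum => rfl
  | verum => rfl
  | eq t₁ t₂ => simp only [subst, Term.subst_var]
  | rel R ts => simp only [subst, Term.subst_var]
  | neg φ ih => simp only [subst, ih]
  | and φ ψ ih₁ ih₂ => simp only [subst, ih₁, ih₂]
  | or φ ψ ih₁ ih₂ => simp only [subst, ih₁, ih₂]
  | all x φ ih => simp only [subst, Function.update_eq_self, ih]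
  | ex x φ ih => simp only [subst, Function.update_eq_self, ih]

theorem inst_self (φ : Formula L) (x : ℕ) : φ.inst x (.var x) = φ := by
  simp only [inst, Function.update_eq_self, subst_var]

theorem inst_of_notMem_freeVars {φ : Formula L} {x : ℕ} (t : Term L) (h : x ∉ φ.freeVars) :
    φ.inst x t = φ := by
  conv_rhs => rw [← φ.subst_var]
  refine φ.subst_congr fun n hn => Function.update_of_ne ?_ _ _
  rintro rfl
  exact h hn

theorem freeVars_subset_vars (φ : Formula L) : φ.freeVars ⊆ φ.vars := by
  induction φ with
  | falsum => exact subset_rfl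
  | verum => exact subset_rfl
  | eq t₁ t₂ => exact subset_rfl
  | rel R ts => exact subset_rfl
  | neg φ ih => exact ih
  | and φ ψ ih₁ ih₂ => exact Finset.union_subset_union ih₁ ih₂
  | or φ ψ ih₁ ih₂ => exact Finset.union_subset_union ih₁ ih₂
  | all x φ ih => exact (Finset.erase_subset _ _).trans (ih.trans (Finset.subset_insert _ _))
  | ex x φ ih => exact (Finset.erase_subset _ _).trans (ih.trans (Finset.subset_insert _ _))

theorem freeFor_of_notMem_vars {y : ℕ} (x : ℕ) {φ : Formula L} (h : y ∉ φ.vars) :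
    FreeFor (.var y) x φ := by
  induction φ with
  | falsum => trivial
  | verum => trivial
  | eq t₁ t₂ => trivial
  | rel R ts => trivial
  | neg φ ih => exact ih h
  | and φ ψ ih₁ ih₂ =>
    simp only [vars, Finset.mem_union, not_or] at h
    exact ⟨ih₁ h.1, ih₂ h.2⟩
  | or φ ψ ih₁ ih₂ =>
    simp only [vars, Finset.mem_union, not_or] at h
    exact ⟨ih₁ h.1, ih₂ h.2⟩
  | all z φ ih =>
    simp only [vars, Finset.mem_insert, not_or] at h
    exact fun _ => ⟨by simpa [Term.vars] using Ne.symm h.1, ih h.2⟩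
  | ex z φ ih =>
    simp only [vars, Finset.mem_insert, not_or] at h
    exact fun _ => ⟨by simpa [Term.vars] using Ne.symm h.1, ih h.2⟩

theorem freeFor_self (x : ℕ) (φ : Formula L) : FreeFor (.var x) x φ := by
  induction φ with
  | falsum => trivial
  | verum => trivial
  | eq t₁ t₂ => trivial
  | rel R ts => trivial
  | neg φ ih => exact ih
  | and φ ψ ih₁ ih₂ => exact ⟨ih₁, ih₂⟩
  | or φ ψ ih₁ ih₂ => exact ⟨ih₁, ih₂⟩
  | all z φ ih => exact fun h => ⟨by simpa [Term.vars] using (Finset.mem_erase.1 h).1.symm, ih⟩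
  | ex z φ ih => exact fun h => ⟨by simpa [Term.vars] using (Finset.mem_erase.1 h).1.symm, ih⟩

theorem exists_of_mem_freeVars_subst {σ : ℕ → Term L} {n : ℕ} (φ : Formula L)
    (h : n ∈ (φ.subst σ).freeVars) : ∃ m ∈ φ.freeVars, n ∈ (σ m).vars := by
  induction φ generalizing σ with
  | falsum => simp [subst, freeVars] at h
  | verum => simp [subst, freeVars] at h
  | eq t₁ t₂ =>
    simp only [subst, freeVars, Finset.mem_union] at h ⊢
    rcases h with h | h
    · obtain ⟨m, hm, hn⟩ := t₁.exists_of_mem_vars_subst h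
      exact ⟨m, .inl hm, hn⟩
    · obtain ⟨m, hm, hn⟩ := t₂.exists_of_mem_vars_subst h
      exact ⟨m, .inr hm, hn⟩
  | rel R ts =>
    simp only [subst, freeVars, Finset.mem_biUnion, Finset.mem_univ, true_and] at h ⊢
    obtain ⟨i, hi⟩ := h
    obtain ⟨m, hm, hn⟩ := (ts i).exists_of_mem_vars_subst hi
    exact ⟨m, ⟨i, hm⟩, hn⟩
  | neg φ ih => exact ih h
  | and φ ψ ih₁ ih₂ =>
    simp only [subst, freeVars, Finset.mem_union] at h ⊢
    rcases h with h | h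
    · obtain ⟨m, hm, hn⟩ := ih₁ h
      exact ⟨m, .inl hm, hn⟩
    · obtain ⟨m, hm, hn⟩ := ih₂ h
      exact ⟨m, .inr hm, hn⟩
  | or φ ψ ih₁ ih₂ =>
    simp only [subst, freeVars, Finset.mem_union] at h ⊢
    rcases h with h | h
    · obtain ⟨m, hm, hn⟩ := ih₁ h
      exact ⟨m, .inl hm, hn⟩
    · obtain ⟨m, hm, hn⟩ := ih₂ h
      exact ⟨m, .inr hm, hn⟩
  | all x φ ih =>
    simp only [subst, freeVars, Finset.mem_erase] at h ⊢
    obtain ⟨m, hm, hn⟩ := ih h.2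
    by_cases hx : m = x
    · subst hx
      simp [Term.vars, h.1] at hn
    · rw [Function.update_of_ne hx] at hn
      exact ⟨m, ⟨hx, hm⟩, hn⟩
  | ex x φ ih =>
    simp only [subst, freeVars, Finset.mem_erase] at h ⊢
    obtain ⟨m, hm, hn⟩ := ih h.2
    by_cases hx : m = x
    · subst hx
      simp [Term.vars, h.1] at hn
    · rw [Function.update_of_ne hx] at hn
      exact ⟨m, ⟨hx, hm⟩, hn⟩

theorem notMem_freeVars_inst {x y : ℕ} (h : y ≠ x) (φ : Formula L) :
    x ∉ (φ.inst x (.var y)).freeVars := by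
  intro hx
  obtain ⟨m, -, hm⟩ := exists_of_mem_freeVars_subst φ hx
  by_cases hmx : m = x
  · subst hmx
    simp [Term.vars, h.symm] at hm
  · rw [Function.update_of_ne hmx] at hm
    simp [Term.vars, Ne.symm hmx] at hm

/-- The nesting depth of a formula. -/
def depth : Formula L → ℕ
  | .falsum => 0
  | .verum => 0
  | .eq _ _ => 0
  | .rel _ _ => 0
  | .neg φ => φ.depth + 1
  | .and φ ψ => max φ.depth ψ.depth + 1
  | .or φ ψ => max φ.depth ψ.depth + 1
  | .all _ φ => φ.depth + 1
  | .ex _ φ => φ.depth + 1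

theorem depth_subst (σ : ℕ → Term L) (φ : Formula L) : (φ.subst σ).depth = φ.depth := by
  induction φ generalizing σ <;> simp_all [subst, depth]

end Formula

/-! ### Derived rules -/

namespace Proves

variable {δ : IsdefFormulas L} {Γ Δ : Set (Formula L)} {φ ψ χ : Formula L}

theorem mono (h : Proves δ Γ φ) (hs : Γ ⊆ Δ) : Proves δ Δ φ := by
  have := P2 Γ Δ φ h
  rwa [Set.union_eq_self_of_subset_left hs] at this

theorem of_mem (h : φ ∈ Γ) : Proves δ Γ φ := (P1 φ).mono (by simpa)

theorem weaken (h : Proves δ Γ φ) : Proves δ (Γ ∪ Δ) φ := P2 _ _ _ h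

theorem last : Proves δ (Γ ∪ {φ}) φ := of_mem (by simp)

theorem of_one (h : Proves δ {φ} ψ) (h₁ : Proves δ Γ φ) : Proves δ Γ ψ :=
  P3 _ _ _ h₁ (h.mono (by simp))

theorem of_two (h : Proves δ {φ, ψ} χ) (h₁ : Proves δ Γ φ) (h₂ : Proves δ Γ ψ) :
    Proves δ Γ χ := by
  refine P3 _ _ _ h₁ (P3 _ _ _ h₂.weaken (h.mono ?_))
  rintro θ (rfl | rfl) <;> simp

theorem andIntro (h₁ : Proves δ Γ φ) (h₂ : Proves δ Γ ψ) : Proves δ Γ (.and φ ψ) :=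
  of_two (andI φ ψ) h₁ h₂

theorem andLeft (h : Proves δ Γ (.and φ ψ)) : Proves δ Γ φ := of_one (andE1 φ ψ) h

theorem andRight (h : Proves δ Γ (.and φ ψ)) : Proves δ Γ ψ := of_one (andE2 φ ψ) h

theorem orLeft (h : Proves δ Γ φ) : Proves δ Γ (.or φ ψ) := of_one (orI1 φ ψ) h

theorem orRight (h : Proves δ Γ ψ) : Proves δ Γ (.or φ ψ) := of_one (orI2 φ ψ) h

theorem orElim (h : Proves δ Γ (.or φ ψ)) (h₁ : Proves δ (Γ ∪ {φ}) χ)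
    (h₂ : Proves δ (Γ ∪ {ψ}) χ) : Proves δ Γ χ :=
  P3 _ _ _ h (orE _ _ _ _ h₁ h₂)

theorem exFalso (h : Proves δ Γ .falsum) : Proves δ Γ φ := of_one (C2 φ) h

theorem absurd (h₁ : Proves δ Γ φ) (h₂ : Proves δ Γ (.neg φ)) : Proves δ Γ ψ :=
  exFalso (of_two (C3 φ) h₁ h₂)

theorem isdef (h : Proves δ Γ φ) : Proves δ Γ (φ.isdef δ) := of_one (D1 φ) h

theorem trichotomy (h : Proves δ (Γ ∪ {φ}) χ) (h₁ : Proves δ (Γ ∪ {.neg φ}) χ)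
    (h₂ : Proves δ (Γ ∪ {.neg (φ.isdef δ)}) χ) : Proves δ Γ χ :=
  orElim ((C1 φ).mono (Set.empty_subset _))
    (orElim last (h.mono (by gcongr; simp)) (h₁.mono (by gcongr; simp))) h₂

theorem byCases (h : Proves δ Γ (φ.isdef δ)) (h₁ : Proves δ (Γ ∪ {φ}) χ)
    (h₂ : Proves δ (Γ ∪ {.neg φ}) χ) : Proves δ Γ χ :=
  trichotomy h₁ h₂ (absurd h.weaken last)

/-- No rule introduces `verum`. But it is its own isdef-formula and that of its negation, so D1
yields it in each of the three cases of C1. -/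
theorem verum : Proves δ Γ .verum :=
  trichotomy (φ := .verum) last (isdef last) (isdef (φ := .neg .verum) last)

/-! ### Derived rules for equality -/

theorem eqRefl {t : Term L} (h : Proves δ Γ (t.isdef δ)) : Proves δ Γ (.eq t t) := of_one (eq1 t) h

theorem eqRefl_var (x : ℕ) : Proves δ Γ (.eq (.var x) (.var x)) := eqRefl verum

theorem eqSubst {σ : ℕ → Term L} {i : ℕ} {t t' : Term L} (h₁ : φ.FreeFor t i)
    (h₂ : φ.FreeFor t' i) (h : Proves δ Γ (.eq t t'))
    (h' : Proves δ Γ (φ.subst (Function.update σ i t))) :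
    Proves δ Γ (φ.subst (Function.update σ i t')) :=
  of_two (eq2 φ σ i t t' h₁ h₂) h h'

theorem eqLeft {t t' : Term L} (h : Proves δ Γ (.eq t t')) : Proves δ Γ (t.isdef δ) :=
  andLeft (isdef h)

theorem eqRight {t t' : Term L} (h : Proves δ Γ (.eq t t')) : Proves δ Γ (t'.isdef δ) :=
  andRight (isdef h)

theorem eqSymm {t t' : Term L} (h : Proves δ Γ (.eq t t')) : Proves δ Γ (.eq t' t) := by
  -- Only the left side is replaced: the constant substitution puts t in the place of the second
  -- variable, so that t = t becomes t' = t.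
  simpa [Formula.subst, Term.subst] using eqSubst (φ := .eq (.var 0) (.var 1)) (σ := fun _ => t) (i := 0)
    trivial trivial h (by simpa [Formula.subst, Term.subst] using eqRefl (eqLeft h))

theorem eqTrans {t t' t'' : Term L} (h : Proves δ Γ (.eq t t')) (h' : Proves δ Γ (.eq t' t'')) :
    Proves δ Γ (.eq t t'') := by
  simpa [Formula.subst, Term.subst] using eqSubst (φ := .eq (.var 0) (.var 1)) (σ := fun _ => t'')
    (i := 0) trivial trivial (eqSymm h) (by simpa [Formula.subst, Term.subst] using h')

/-- Simultaneous replacement of equals in a formula without quantifiers. -/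
theorem eqSubst_finset {σ σ' : ℕ → Term L} (hφ : ∀ t i, φ.FreeFor t i) (s : Finset ℕ)
    (h : ∀ i ∈ s, Proves δ Γ (.eq (σ i) (σ' i))) (h' : Proves δ Γ (φ.subst σ)) :
    Proves δ Γ (φ.subst fun i => if i ∈ s then σ' i else σ i) := by
  induction s using Finset.induction_on with
  | empty => simpa using h'
  | insert a s ha ih =>
    have h₁ := ih fun i hi => h i (Finset.mem_insert_of_mem hi)
    have e₁ : (fun i => if i ∈ s then σ' i else σ i) =
        Function.update (fun i => if i ∈ s then σ' i else σ i) a (σ a) := by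
      rw [eq_comm, Function.update_eq_self_iff]; simp [ha]
    have e₂ : (fun i => if i ∈ insert a s then σ' i else σ i) =
        Function.update (fun i => if i ∈ s then σ' i else σ i) a (σ' a) := by
      funext i
      by_cases hi : i = a
      · simp [hi]
      · simp [hi]
    rw [e₁] at h₁
    rw [e₂]
    exact eqSubst (hφ _ _) (hφ _ _) (h a (Finset.mem_insert_self _ _)) h₁

theorem eqSubst_lt {σ σ' : ℕ → Term L} (hφ : ∀ t i, φ.FreeFor t i) {n : ℕ}
    (hn : ∀ i ∈ φ.freeVars, i < n)
    (h : ∀ i < n, Proves δ Γ (.eq (σ i) (σ' i))) (h' : Proves δ Γ (φ.subst σ)) :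
    Proves δ Γ (φ.subst σ') := by
  have := eqSubst_finset hφ (Finset.range n) (fun i hi => h i (Finset.mem_range.1 hi)) h'
  rwa [φ.subst_congr (τ := σ') fun i hi => by simp [hn i hi]] at this

theorem rel_congr {R : L.Rel} {ts ts' : Fin (L.relArity R) → Term L}
    (h : ∀ i, Proves δ Γ (.eq (ts i) (ts' i))) (h' : Proves δ Γ (.rel R ts)) :
    Proves δ Γ (.rel R ts') := by
  have := eqSubst_lt (δ := δ) (Γ := Γ) (φ := .rel R fun i => .var i) (σ := argSubst ts)
    (σ' := argSubst ts') (n := L.relArity R) (fun _ _ => trivial)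
    (by simp [Formula.freeVars, Term.vars]) (fun i hi => by simpa [argSubst, hi] using h ⟨i, hi⟩)
    (by simpa [Formula.subst, Term.subst, argSubst] using h')
  simpa [Formula.subst, Term.subst, argSubst] using this

theorem func_congr {f : L.Func} {ts ts' : Fin (L.funcArity f) → Term L} {t : Term L}
    (h : ∀ i, Proves δ Γ (.eq (ts i) (ts' i))) (h' : Proves δ Γ (.eq (.func f ts) t)) :
    Proves δ Γ (.eq (.func f ts') t) := by
  -- The first variable beyond the argument places stands for the right side t. It is replaced by
  -- itself, which is allowed because t is provably defined.
  have key : ∀ us : Fin (L.funcArity f) → Term L,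
      (Formula.eq (.func f fun i => .var i) (.var (L.funcArity f))).subst
        (fun k => if h : k < L.funcArity f then us ⟨k, h⟩ else t) = .eq (.func f us) t := by
    intro us
    simp [Formula.subst, Term.subst]
  have ht := eqRefl (eqRight h')
  rw [← key] at h' ⊢
  refine eqSubst_lt (n := L.funcArity f + 1) (fun _ _ => trivial) ?_ ?_ h'
  · simp only [Formula.freeVars, Term.vars, Finset.mem_union, Finset.mem_biUnion]
    rintro i (⟨j, -, hj⟩ | hi)
    · rw [Finset.mem_singleton.1 hj]; omega
    · rw [Finset.mem_singleton.1 hi]; omega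
  · intro i hi
    by_cases hi' : i < L.funcArity f
    · simpa [hi'] using h ⟨i, hi'⟩
    · simpa [hi'] using ht

theorem conj_iff {l : List (Formula L)} :
    Proves δ Γ (Formula.conj l) ↔ ∀ φ ∈ l, Proves δ Γ φ := by
  have key : ∀ (l : List (Formula L)) (φ : Formula L),
      Proves δ Γ (l.foldl .and φ) ↔ Proves δ Γ φ ∧ ∀ ψ ∈ l, Proves δ Γ ψ := by
    intro l
    induction l with
    | nil => simp
    | cons ψ l ih =>
      intro φ
      simp only [List.foldl_cons, ih, List.mem_cons, forall_eq_or_imp]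
      exact ⟨fun h => ⟨andLeft h.1, andRight h.1, h.2⟩, fun h => ⟨andIntro h.1 h.2.1, h.2.2⟩⟩
  cases l with
  | nil => simpa [Formula.conj] using verum
  | cons φ l => simp [Formula.conj, key]

/-! ### Derived rules for quantifiers -/

theorem allElim {x y : ℕ} (h : Proves δ Γ (.all x φ)) (hy : φ.FreeFor (.var y) x) :
    Proves δ Γ (φ.inst x (.var y)) :=
  of_two (allE φ x (.var y) hy) verum h

theorem allElim_self {x : ℕ} (h : Proves δ Γ (.all x φ)) : Proves δ Γ φ := by
  simpa [Formula.inst_self] using allElim h (Formula.freeFor_self x φ)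

theorem exIntro {x : ℕ} {t : Term L} (ht : φ.FreeFor t x) (h : Proves δ Γ (φ.inst x t)) :
    Proves δ Γ (.ex x φ) := of_one (exI φ x t ht) h

theorem exIntro_self {x : ℕ} (h : Proves δ Γ φ) : Proves δ Γ (.ex x φ) :=
  exIntro (Formula.freeFor_self x φ) (by rwa [Formula.inst_self])

theorem exists_eq {t : Term L} {x : ℕ} (hx : x ∉ t.vars) (h : Proves δ Γ (t.isdef δ)) :
    Proves δ Γ (.ex x (.eq t (.var x))) := by
  refine exIntro (t := t) trivial ?_
  have : t.subst (Function.update Term.var x t) = t := by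
    conv_rhs => rw [← t.subst_var]
    refine t.subst_congr fun n hn => Function.update_of_ne ?_ _ _
    rintro rfl
    exact hx hn
  simpa [Formula.inst, Formula.subst, Term.subst, this] using eqRefl h

/-- A provable sequent remains provable when a fresh variable is put in the place of a variable. -/
theorem inst_var {x y : ℕ} (h : Proves δ {φ} ψ) (hxy : y ≠ x) (hφ : y ∉ φ.vars)
    (hψ : y ∉ ψ.vars) : Proves δ {φ.inst x (.var y)} (ψ.inst x (.var y)) := by
  set Γ : Set (Formula L) := {φ.inst x (.var y)} with hΓ
  -- Under y = x, φ(y) becomes φ and the resulting ψ becomes ψ(y). The equation is defined, so it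
  -- can be moved into the disjunction `h₃`. As x is not free in φ(y), `h₃` can be generalized over
  -- x; its instance at y has the refutable disjunct ¬(y = y).
  have h₁ : Proves δ (Γ ∪ {.eq (.var y) (.var x)}) ψ := by
    refine of_one h ?_
    have := eqSubst (δ := δ) (Γ := Γ ∪ {.eq (.var y) (.var x)}) (σ := Term.var) (i := x)
      (Formula.freeFor_of_notMem_vars x hφ) (Formula.freeFor_self x φ) last
      (weaken (of_mem (by simp [hΓ, Formula.inst])))
    rwa [Function.update_eq_self, Formula.subst_var] at this
  have h₂ : Proves δ (Γ ∪ {.eq (.var y) (.var x)}) (ψ.inst x (.var y)) := by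
    refine eqSubst (Formula.freeFor_self x ψ) (Formula.freeFor_of_notMem_vars x hψ)
      (eqSymm last) (σ := Term.var) ?_
    rwa [Function.update_eq_self, Formula.subst_var]
  have h₃ : Proves δ Γ (.or (.neg (.eq (.var y) (.var x))) (ψ.inst x (.var y))) :=
    byCases (andIntro verum verum) (orRight h₂) (orLeft last)
  have h₄ := allI Γ _ x h₃ (by
    simp only [hΓ, Set.mem_singleton_iff, forall_eq]
    exact Formula.notMem_freeVars_inst hxy φ)
  have h₅ := of_two (allE (δ := δ) (Formula.or (.neg (.eq (.var y) (.var x))) (ψ.inst x (.var y)))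
    x (.var y) ⟨trivial, ?_⟩) verum h₄
  · simp only [Formula.inst, Formula.subst, Term.subst, Function.update_self,
      Function.update_of_ne hxy] at h₅
    refine orElim h₅ (absurd (eqRefl_var y) last) ?_
    have := Formula.inst_of_notMem_freeVars (.var y) (Formula.notMem_freeVars_inst hxy ψ)
    simp only [Formula.inst] at this ⊢
    rw [this]
    exact last
  · have key : ∀ θ : Formula L, x ∉ θ.freeVars → θ.FreeFor (.var y) x := by
      intro θ
      induction θ with
      | falsum => exact fun _ => trivial
      | verum => exact fun _ => trivial
      | eq _ _ => exact fun _ => trivial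
      | rel _ _ => exact fun _ => trivial
      | neg θ ih => exact ih
      | and θ θ' ih₁ ih₂ =>
        intro h
        simp only [Formula.freeVars, Finset.mem_union, not_or] at h
        exact ⟨ih₁ h.1, ih₂ h.2⟩
      | or θ θ' ih₁ ih₂ =>
        intro h
        simp only [Formula.freeVars, Finset.mem_union, not_or] at h
        exact ⟨ih₁ h.1, ih₂ h.2⟩
      | all z θ ih => exact fun h h' => (h h').elim
      | ex z θ ih => exact fun h h' => (h h').elim
    exact key _ (Formula.notMem_freeVars_inst hxy ψ)

theorem all_of_not_ex_neg {x : ℕ} (h : Proves δ Γ (.neg (.ex x (.neg φ))))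
    (h' : Proves δ Γ (.all x (φ.isdef δ))) : Proves δ Γ (.all x φ) := by
  -- In Γ the variable x may be free; these two hypotheses alone permit ∀I.
  have : Proves δ {.neg (.ex x (.neg φ)), .all x (φ.isdef δ)} (.all x φ) := by
    refine allI _ _ _ ?_ (by simp [Formula.freeVars])
    refine byCases (allElim_self (x := x) (of_mem (by simp))) last ?_
    exact absurd (exIntro_self (x := x) last) (weaken (of_mem (by simp)))
  exact of_two this h h'

/-- Derivations are finite trees. At a rule that discharges a hypothesis, that hypothesis is deleted
from the finite set of the premise, so that what remains lies in Γ. -/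
theorem exists_finite (h : Proves δ Γ φ) : ∃ Δ ⊆ Γ, Δ.Finite ∧ Proves δ Δ φ := by
  have diff : ∀ {Γ Δ : Set (Formula L)} {φ : Formula L}, Δ ⊆ Γ ∪ {φ} → Δ \ {φ} ⊆ Γ := by
    intro Γ Δ φ h θ hθ
    exact (h hθ.1).resolve_right hθ.2
  induction h with
  | P1 φ => exact ⟨_, subset_rfl, Set.toFinite _, P1 φ⟩
  | P2 Γ Δ φ _ ih =>
    obtain ⟨Δ', hs, hf, h⟩ := ih
    exact ⟨Δ', hs.trans Set.subset_union_left, hf, h⟩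
  | P3 Γ φ ψ _ _ ih₁ ih₂ =>
    obtain ⟨Δ₁, hs₁, hf₁, h₁⟩ := ih₁
    obtain ⟨Δ₂, hs₂, hf₂, h₂⟩ := ih₂
    refine ⟨Δ₁ ∪ Δ₂ \ {φ}, Set.union_subset hs₁ (diff hs₂), hf₁.union hf₂.sdiff, ?_⟩
    refine P3 _ φ _ h₁.weaken (h₂.mono fun θ hθ => ?_)
    by_cases e : θ = φ <;> simp [e, hθ]
  | C1 φ => exact ⟨_, subset_rfl, Set.toFinite _, C1 φ⟩
  | C2 φ => exact ⟨_, subset_rfl, Set.toFinite _, C2 φ⟩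
  | C3 φ => exact ⟨_, subset_rfl, Set.toFinite _, C3 φ⟩
  | D1 φ => exact ⟨_, subset_rfl, Set.toFinite _, D1 φ⟩
  | andI φ ψ => exact ⟨_, subset_rfl, Set.toFinite _, andI φ ψ⟩
  | andE1 φ ψ => exact ⟨_, subset_rfl, Set.toFinite _, andE1 φ ψ⟩
  | andE2 φ ψ => exact ⟨_, subset_rfl, Set.toFinite _, andE2 φ ψ⟩
  | orI1 φ ψ => exact ⟨_, subset_rfl, Set.toFinite _, orI1 φ ψ⟩
  | orI2 φ ψ => exact ⟨_, subset_rfl, Set.toFinite _, orI2 φ ψ⟩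
  | orE Γ φ ψ χ _ _ ih₁ ih₂ =>
    obtain ⟨Δ₁, hs₁, hf₁, h₁⟩ := ih₁
    obtain ⟨Δ₂, hs₂, hf₂, h₂⟩ := ih₂
    refine ⟨(Δ₁ \ {φ} ∪ Δ₂ \ {ψ}) ∪ {.or φ ψ},
      Set.union_subset_union_left _ (Set.union_subset (diff hs₁) (diff hs₂)),
      (hf₁.sdiff.union hf₂.sdiff).union (Set.finite_singleton _), orE _ _ _ _ ?_ ?_⟩
    · refine h₁.mono fun θ hθ => ?_
      by_cases e : θ = φ <;> simp [e, hθ]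
    · refine h₂.mono fun θ hθ => ?_
      by_cases e : θ = ψ <;> simp [e, hθ]
  | eq1 t => exact ⟨_, subset_rfl, Set.toFinite _, eq1 t⟩
  | eq2 φ σ i t t' h h' => exact ⟨_, subset_rfl, Set.toFinite _, eq2 φ σ i t t' h h'⟩
  | allE φ x t h => exact ⟨_, subset_rfl, Set.toFinite _, allE φ x t h⟩
  | allI Γ φ x _ hx ih =>
    obtain ⟨Δ, hs, hf, h⟩ := ih
    exact ⟨Δ, hs, hf, allI _ _ _ h fun ψ hψ => hx ψ (hs hψ)⟩
  | exI φ x t h => exact ⟨_, subset_rfl, Set.toFinite _, exI φ x t h⟩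
  | exE Γ φ ψ x y _ hΓ hφ hψ ih =>
    obtain ⟨Δ, hs, hf, h⟩ := ih
    refine ⟨Δ \ {φ.inst x (.var y)} ∪ {.ex x φ}, Set.union_subset_union_left _ (diff hs),
      hf.sdiff.union (Set.finite_singleton _), exE _ φ ψ x y ?_ ?_ hφ hψ⟩
    · refine h.mono fun θ hθ => ?_
      by_cases e : θ = φ.inst x (.var y) <;> simp [e, hθ]
    · exact fun χ hχ => hΓ χ (diff hs hχ)

end Proves

/-! ### Countability of the language -/

/-- The number of arguments of a symbol that may head a term. -/
def headArity (L : Signature) : ℕ ⊕ L.Const ⊕ L.Func → ℕ :=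
  Sum.elim (fun _ => 0) (Sum.elim (fun _ => 0) L.funcArity)

/-- The syntax tree of a term. -/
def Term.toTree : Term L → WType fun a => Fin (headArity L a)
  | .var n => .mk (.inl n) Fin.elim0
  | .const c => .mk (.inr (.inl c)) Fin.elim0
  | .func f ts => .mk (.inr (.inr f)) fun i => (ts i).toTree

theorem Term.toTree_injective : Function.Injective (Term.toTree (L := L)) := by
  intro t
  induction t with
  | var n => intro t' h; cases t' <;> simp only [Term.toTree] at h <;> injection h with h _ <;> simp_all
  | const c => intro t' h; cases t' <;> simp only [Term.toTree] at h <;> injection h with h _ <;> simp_all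
  | func f ts ih =>
    intro t' h
    cases t' with
    | var n => simp only [Term.toTree] at h; injection h with h _; simp at h
    | const c => simp only [Term.toTree] at h; injection h with h _; simp at h
    | func g us =>
      simp only [Term.toTree, WType.mk.injEq, Sum.inr.injEq] at h
      obtain ⟨rfl, h⟩ := h
      congr 1
      funext i
      exact ih i (congrFun (eq_of_heq h) i)

instance Term.countable : Countable (Term L) := by
  have := L.countable_const
  have := L.countable_func
  have : Encodable (ℕ ⊕ L.Const ⊕ L.Func) := Encodable.ofCountable _
  exact Term.toTree_injective.countable

/-- Every formula of depth less than n + 1 is atomic or a constructor applied to formulas of depth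
less than n, so countability propagates by induction on n. -/
instance Formula.countable : Countable (Formula L) := by
  have := L.countable_rel
  have key : ∀ n, {φ : Formula L | φ.depth < n}.Countable := by
    intro n
    induction n with
    | zero => simp
    | succ n ih =>
      set S := {φ : Formula L | φ.depth < n}
      refine Set.Countable.mono (s₂ := {.falsum, .verum} ∪
        (Set.range fun p : Term L × Term L => Formula.eq p.1 p.2) ∪
        (Set.range fun p : Σ R : L.Rel, Fin (L.relArity R) → Term L => Formula.rel p.1 p.2) ∪
        Formula.neg '' S ∪ Set.image2 Formula.and S S ∪ Set.image2 Formula.or S S ∪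
        (⋃ x, Formula.all x '' S) ∪ ⋃ x, Formula.ex x '' S) ?_ ?_
      · intro φ hφ
        cases φ <;>
          simp only [Formula.depth, Set.mem_ofPred_eq, Nat.add_lt_add_iff_right, sup_lt_iff] at hφ <;>
          simp [S, hφ]
      · refine .union (.union (.union (.union (.union (.union (.union ?_ ?_) ?_) ?_) ?_) ?_) ?_) ?_
        · exact (Set.toFinite _).countable
        · exact Set.countable_range _
        · exact Set.countable_range _
        · exact ih.image _
        · exact ih.image2 ih _
        · exact ih.image2 ih _
        · exact Set.countable_iUnion fun x => ih.image _
        · exact Set.countable_iUnion fun x => ih.image _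
  have : (Set.univ : Set (Formula L)).Countable :=
    (Set.countable_iUnion key).mono fun φ _ => Set.mem_iUnion.2 ⟨φ.depth + 1, Nat.lt_succ_self _⟩
  exact Set.countable_univ_iff.1 this

/-! ### Henkin theories -/

variable {δ : IsdefFormulas L}

/-- A maximal consistent set of formulas in which every existential formula has witnesses that are
variables outside of any given finite set. -/
structure IsHenkin (δ : IsdefFormulas L) (T : Set (Formula L)) : Prop where
  consistent : ¬ Proves δ T .falsum
  maximal : ∀ φ, φ ∉ T → Proves δ (T ∪ {φ}) .falsum
  witness : ∀ x φ, .ex x φ ∈ T → ∀ A : Finset ℕ, ∃ y ∉ A, φ.inst x (.var y) ∈ T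

/-- A Rasiowa–Sikorski argument: there are countably many requirements, one for each formula and
each finite set of variables to avoid. Each is cofinal among the finite extensions consistent with
Γ, so one ideal meets all of them, and its union is the theory. -/
theorem exists_isHenkin {Γ : Set (Formula L)} (hΓ : ¬ Proves δ Γ .falsum)
    (hinf : {y | ∀ φ ∈ Γ, y ∉ φ.vars}.Infinite) : ∃ T, Γ ⊆ T ∧ IsHenkin δ T := by
  classical
  let P := {F : Finset (Formula L) // ¬ Proves δ (Γ ∪ F) .falsum}
  let good (i : Formula L × Finset ℕ) : Set P := {F | Proves δ (Γ ∪ F.1 ∪ {i.1}) .falsum ∨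
    i.1 ∈ F.1 ∧ ∀ x φ, i.1 = .ex x φ → ∃ y ∉ i.2, φ.inst x (.var y) ∈ F.1}
  have hgood : ∀ i, IsCofinal (good i) := by
    rintro ⟨θ, A⟩ ⟨F, hF⟩
    by_cases hθ : Proves δ (Γ ∪ F ∪ {θ}) .falsum
    · exact ⟨⟨F, hF⟩, .inl hθ, le_rfl⟩
    by_cases hex : ∃ x φ, θ = .ex x φ
    · obtain ⟨x, φ, rfl⟩ := hex
      -- Such a y satisfies the side conditions of ∃E, so a contradiction after adding φ(y) would
      -- already follow from ∃x φ.
      obtain ⟨y, hy, hyn⟩ := hinf.exists_notMem_finset (A ∪ F.biUnion Formula.vars ∪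
        (Formula.ex x φ).vars)
      simp only [Finset.mem_union, Finset.mem_biUnion, not_or, not_exists, not_and] at hyn
      refine ⟨⟨insert (φ.inst x (.var y)) (insert (.ex x φ) F), fun h => hθ ?_⟩,
        .inr ⟨by simp, ?_⟩, ?_⟩
      · have h' := Proves.exE (Γ ∪ F ∪ {.ex x φ}) φ .falsum x y (h.mono (by
          rw [Finset.coe_insert, Finset.coe_insert]
          intro ψ
          simp only [Set.mem_union, Set.mem_insert_iff, Set.mem_singleton_iff]
          tauto)) ?_ hyn.2 (by simp [Formula.vars])
        · exact h'.mono (by simp)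
        · rintro χ ((hχ | hχ) | rfl)
          · exact hy χ hχ
          · exact hyn.1.2 χ hχ
          · exact hyn.2
      · intro x' φ' e
        cases e
        exact ⟨y, hyn.1.1, by simp⟩
      · exact fun ψ hψ => by simp [hψ]
    · refine ⟨⟨insert θ F, fun h => hθ (h.mono ?_)⟩, .inr ⟨by simp, ?_⟩, ?_⟩
      · rw [Finset.coe_insert, Set.union_assoc, Set.union_singleton (s := (F : Set (Formula L)))]
      · exact fun x φ e => (hex ⟨x, φ, e⟩).elim
      · exact Finset.subset_insert _ _
  have : Encodable (Formula L × Finset ℕ) := Encodable.ofCountable _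
  let D : Formula L × Finset ℕ → Order.Cofinal P := fun i => ⟨good i, hgood i⟩
  let p : P := ⟨∅, by simpa using hΓ⟩
  let I := Order.idealOfCofinals p D
  let T : Set (Formula L) := {θ | ∃ F ∈ I, θ ∈ F.1}
  have hmeet : ∀ i, ∃ F ∈ I, F ∈ good i := fun i => by
    obtain ⟨F, h₁, h₂⟩ := Order.cofinal_meets_idealOfCofinals p D i
    exact ⟨F, h₂, h₁⟩
  have hΓT : Γ ⊆ T := by
    intro θ hθ
    obtain ⟨F, hI, h | h⟩ := hmeet (θ, ∅)
    · exact (F.2 (h.mono (Set.union_subset subset_rfl (by simp [hθ])))).elim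
    · exact ⟨F, hI, h.1⟩
  have hcons : ¬ Proves δ T .falsum := by
    intro h
    obtain ⟨Δ, hs, hf, h⟩ := h.exists_finite
    -- The ideal is directed, so a finite part of its union lies in a single member, which is
    -- consistent.
    have : ∃ F ∈ I, Δ ⊆ F.1 := by
      clear h
      induction Δ, hf using Set.Finite.induction_on with
      | empty => exact ⟨p, Order.mem_idealOfCofinals p D, by simp⟩
      | insert _ _ ih =>
        obtain ⟨F, hF, hs'⟩ := ih ((Set.subset_insert _ _).trans hs)
        obtain ⟨G, hG, hm⟩ := hs (Set.mem_insert _ _)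
        obtain ⟨H, hH, hFH, hGH⟩ := I.directed F hF G hG
        exact ⟨H, hH, Set.insert_subset (hGH hm) (hs'.trans hFH)⟩
    obtain ⟨F, -, hF⟩ := this
    exact F.2 (h.mono (hF.trans Set.subset_union_right))
  refine ⟨T, hΓT, hcons, ?_, ?_⟩
  · intro θ hθ
    obtain ⟨F, hI, h | h⟩ := hmeet (θ, ∅)
    · exact h.mono (Set.union_subset_union_left _ (Set.union_subset hΓT fun ψ hψ => ⟨F, hI, hψ⟩))
    · exact (hθ ⟨F, hI, h.1⟩).elim
  · intro x φ hφ A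
    obtain ⟨F, hI, h | h⟩ := hmeet (.ex x φ, A)
    · exact (hcons (h.mono (Set.union_subset (Set.union_subset hΓT fun ψ hψ => ⟨F, hI, hψ⟩)
        (by simpa using hφ)))).elim
    · obtain ⟨y, hy, hm⟩ := h.2 x φ rfl
      exact ⟨y, hy, F, hI, hm⟩

/-! ### Kleene truth conditions for membership in a Henkin theory -/

namespace IsHenkin

variable {T : Set (Formula L)} {φ ψ : Formula L}

theorem mem_of_proves (hT : IsHenkin δ T) (h : Proves δ T φ) : φ ∈ T := by
  by_contra hφ
  exact hT.consistent (.P3 _ _ _ h (hT.maximal φ hφ))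

theorem mem_iff (hT : IsHenkin δ T) : φ ∈ T ↔ Proves δ T φ :=
  ⟨.of_mem, hT.mem_of_proves⟩

theorem not_mem_both (hT : IsHenkin δ T) (h : φ ∈ T) : .neg φ ∉ T := fun h' =>
  hT.consistent (.absurd (.of_mem h) (.of_mem h'))

theorem isdef_mem (hT : IsHenkin δ T) (h : φ ∈ T) : φ.isdef δ ∈ T :=
  hT.mem_of_proves (.isdef (.of_mem h))

theorem isdef_mem_of_neg (hT : IsHenkin δ T) (h : .neg φ ∈ T) : φ.isdef δ ∈ T :=
  hT.mem_of_proves (.isdef (φ := .neg φ) (.of_mem h))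

theorem and_mem (hT : IsHenkin δ T) : .and φ ψ ∈ T ↔ φ ∈ T ∧ ψ ∈ T := by
  simp only [hT.mem_iff]
  exact ⟨fun h => ⟨h.andLeft, h.andRight⟩, fun h => .andIntro h.1 h.2⟩

theorem or_mem (hT : IsHenkin δ T) : .or φ ψ ∈ T ↔ φ ∈ T ∨ ψ ∈ T := by
  constructor
  · intro h
    by_contra! hn
    exact hT.consistent (.orElim (.of_mem h) (hT.maximal _ hn.1) (hT.maximal _ hn.2))
  · simp only [hT.mem_iff]
    rintro (h | h)
    · exact h.orLeft
    · exact h.orRight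

theorem trichotomy (hT : IsHenkin δ T) (φ : Formula L) :
    φ ∈ T ∨ .neg φ ∈ T ∨ .neg (φ.isdef δ) ∈ T := by
  have := hT.mem_of_proves ((Proves.C1 φ).mono (Set.empty_subset _))
  rwa [hT.or_mem, hT.or_mem, or_assoc] at this

theorem mem_or_neg_mem (hT : IsHenkin δ T) (h : φ.isdef δ ∈ T) : φ ∈ T ∨ .neg φ ∈ T :=
  (hT.trichotomy φ).imp_right fun h' => h'.resolve_right (hT.not_mem_both h)

theorem neg_mem_of_isdef (hT : IsHenkin δ T) (h : φ.isdef δ ∈ T) : .neg φ ∈ T ↔ φ ∉ T :=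
  ⟨fun h' h'' => hT.not_mem_both h'' h', (hT.mem_or_neg_mem h).resolve_left⟩

theorem neg_neg_mem (hT : IsHenkin δ T) : .neg (.neg φ) ∈ T ↔ φ ∈ T := by
  constructor
  · intro h
    refine (hT.mem_or_neg_mem (φ := φ) ?_).resolve_right fun h' => hT.not_mem_both h' h
    exact hT.isdef_mem_of_neg (φ := .neg φ) h
  · intro h
    exact (hT.neg_mem_of_isdef (φ := .neg φ) (hT.isdef_mem (φ := φ) h)).2 (hT.not_mem_both h)

/-- The disjuncts of ⌈φ ∧ ψ⌉ list the ways a Kleene conjunction gets a classical value: both sides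
defined, left side false, right side false. The last two give the claim outright; in the first,
membership of both conjuncts would contradict the negation. -/
theorem neg_and_mem (hT : IsHenkin δ T) :
    .neg (.and φ ψ) ∈ T ↔ .neg φ ∈ T ∨ .neg ψ ∈ T := by
  constructor
  · intro h
    have hd := hT.isdef_mem_of_neg h
    simp only [Formula.isdef, hT.or_mem, hT.and_mem] at hd
    rcases hd with (hd | hd) | hd
    · by_contra! hn
      exact hT.not_mem_both (hT.and_mem.2 ⟨(hT.mem_or_neg_mem hd.1).resolve_right hn.1,
        (hT.mem_or_neg_mem hd.2).resolve_right hn.2⟩) h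
    · exact .inl hd.2
    · exact .inr hd.2
  · intro h
    refine (hT.neg_mem_of_isdef ?_).2 ?_
    · simp only [Formula.isdef, hT.or_mem, hT.and_mem]
      exact h.elim (fun h => .inl (.inr ⟨hT.isdef_mem_of_neg h, h⟩))
        fun h => .inr ⟨hT.isdef_mem_of_neg h, h⟩
    · rw [hT.and_mem]
      exact fun h' => h.elim (hT.not_mem_both h'.1) (hT.not_mem_both h'.2)

theorem neg_or_mem (hT : IsHenkin δ T) :
    .neg (.or φ ψ) ∈ T ↔ .neg φ ∈ T ∧ .neg ψ ∈ T := by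
  constructor
  · intro h
    have hn := fun h' => hT.not_mem_both (φ := .or φ ψ) h' h
    have hd := hT.isdef_mem_of_neg h
    simp only [Formula.isdef, hT.or_mem, hT.and_mem] at hd hn
    rw [imp_false, not_or] at hn
    rcases hd with (hd | hd) | hd
    · exact ⟨(hT.neg_mem_of_isdef hd.1).2 hn.1, (hT.neg_mem_of_isdef hd.2).2 hn.2⟩
    · exact (hn.1 hd.2).elim
    · exact (hn.2 hd.2).elim
  · intro h
    refine (hT.neg_mem_of_isdef ?_).2 ?_
    · simp only [Formula.isdef, hT.or_mem, hT.and_mem]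
      exact .inl (.inl ⟨hT.isdef_mem_of_neg h.1, hT.isdef_mem_of_neg h.2⟩)
    · rw [hT.or_mem]
      exact fun h' => h'.elim (fun h' => hT.not_mem_both h' h.1) fun h' => hT.not_mem_both h' h.2

theorem conj_mem (hT : IsHenkin δ T) {l : List (Formula L)} :
    Formula.conj l ∈ T ↔ ∀ φ ∈ l, φ ∈ T := by
  simp only [hT.mem_iff, Proves.conj_iff]

theorem inst_mem_of_all_mem (hT : IsHenkin δ T) {x y : ℕ} (h : .all x φ ∈ T)
    (hy : y ∉ φ.vars) : φ.inst x (.var y) ∈ T :=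
  hT.mem_of_proves (.allElim (.of_mem h) (Formula.freeFor_of_notMem_vars x hy))

theorem ex_mem_of_inst_mem (hT : IsHenkin δ T) {x y : ℕ} (h : φ.inst x (.var y) ∈ T)
    (hy : y ∉ φ.vars) : .ex x φ ∈ T :=
  hT.mem_of_proves (.exIntro (Formula.freeFor_of_notMem_vars x hy) (.of_mem h))

/-- Used with D1 to pass from φ(y) or ¬φ(y) to ⌈φ⌉(y), which need not coincide literally with
⌈φ(y)⌉. -/
theorem inst_mem (hT : IsHenkin δ T) {x y : ℕ} (h : Proves δ {φ} ψ)
    (hφ : φ.inst x (.var y) ∈ T) (hxy : y ≠ x) (hyφ : y ∉ φ.vars) (hyψ : y ∉ ψ.vars) :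
    ψ.inst x (.var y) ∈ T :=
  hT.mem_of_proves (.of_one (h.inst_var hxy hyφ hyψ) (.of_mem hφ))

/-- A negated universal formula has a counterexample outside of any finite set. -/
theorem exists_neg_inst_mem (hT : IsHenkin δ T) {x : ℕ} (h : .neg (.all x φ) ∈ T)
    (A : Finset ℕ) : ∃ y ∉ A, .neg (φ.inst x (.var y)) ∈ T := by
  have hd := hT.isdef_mem_of_neg h
  simp only [Formula.isdef, hT.or_mem] at hd
  rcases hd with hd | hd
  -- Here ∀x ⌈φ⌉ ∈ T, so ∃x ¬φ is defined; were its negation in T, ∀x φ would follow.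
  · suffices .ex x (.neg φ) ∈ T from hT.witness x _ this A
    refine (hT.mem_or_neg_mem (φ := .ex x (.neg φ)) (hT.or_mem.2 (.inl hd))).resolve_right fun hn => ?_
    exact hT.not_mem_both (hT.mem_of_proves (.all_of_not_ex_neg (.of_mem hn) (.of_mem hd))) h
  · obtain ⟨y, hy, hm⟩ := hT.witness x _ hd A
    exact ⟨y, hy, (hT.and_mem.1 hm).2⟩

/-- If ∀x φ were false, a counterexample outside A would exist. If it were undefined, then ¬∀x ⌈φ⌉ ∈
T, and a fresh counterexample y to ⌈φ⌉ contradicts ⌈φ⌉(y), which follows from φ(y). -/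
theorem all_mem_of_inst_mem (hT : IsHenkin δ T) {x : ℕ} (A : Finset ℕ)
    (h : ∀ y ∉ A, φ.inst x (.var y) ∈ T) : .all x φ ∈ T := by
  rcases hT.trichotomy (.all x φ) with h' | h' | h'
  · exact h'
  · obtain ⟨y, hy, hn⟩ := hT.exists_neg_inst_mem h' A
    exact (hT.not_mem_both (h y hy) hn).elim
  · obtain ⟨y, hy, hn⟩ := hT.exists_neg_inst_mem (hT.neg_or_mem.1 h').1
      (A ∪ {x} ∪ φ.vars ∪ (φ.isdef δ).vars)
    simp only [Finset.mem_union, Finset.mem_singleton, not_or] at hy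
    exact (hT.not_mem_both (hT.inst_mem (.D1 φ) (h y hy.1.1.1) hy.1.1.2 hy.1.2 hy.2) hn).elim

theorem neg_all_mem_of_neg_inst_mem (hT : IsHenkin δ T) {x y : ℕ}
    (h : .neg (φ.inst x (.var y)) ∈ T) (hxy : y ≠ x) (hy : y ∉ φ.vars)
    (hy' : y ∉ (φ.isdef δ).vars) : .neg (.all x φ) ∈ T := by
  refine (hT.neg_mem_of_isdef ?_).2 fun h' => hT.not_mem_both (hT.inst_mem_of_all_mem h' hy) h
  refine hT.or_mem.2 (.inr (hT.ex_mem_of_inst_mem (y := y) (hT.and_mem.2 ⟨?_, h⟩) ?_))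
  · exact hT.inst_mem (φ := .neg φ) (.D1 (.neg φ)) h hxy hy hy'
  · simp [Formula.vars, hy, hy']

theorem neg_inst_mem_of_neg_ex_mem (hT : IsHenkin δ T) {x y : ℕ} (h : .neg (.ex x φ) ∈ T)
    (hy : y ∉ φ.vars) (hy' : y ∉ (φ.isdef δ).vars) : .neg (φ.inst x (.var y)) ∈ T := by
  have hd := hT.isdef_mem_of_neg h
  simp only [Formula.isdef, hT.or_mem] at hd
  rcases hd with hd | hd
  -- C1 for φ is generalized over x before y is put in, so its last disjunct speaks of ⌈φ⌉(y) and is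
  -- refuted by ∀x ⌈φ⌉; C1 for φ(y) would speak of ⌈φ(y)⌉.
  · have h₁ : Formula.inst (.or (.or φ (.neg φ)) (.neg (φ.isdef δ))) x (.var y) ∈ T :=
      hT.inst_mem_of_all_mem (hT.mem_of_proves ((Proves.allI ∅ _ x (.C1 φ) (by simp)).mono
        (Set.empty_subset _))) (by simp [Formula.vars, hy, hy'])
    rw [show Formula.inst (.or (.or φ (.neg φ)) (.neg (φ.isdef δ))) x (.var y) =
      .or (.or (φ.inst x (.var y)) (.neg (φ.inst x (.var y))))
        (.neg ((φ.isdef δ).inst x (.var y))) from rfl, hT.or_mem, hT.or_mem] at h₁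
    rcases h₁ with (h₁ | h₁) | h₁
    · exact (hT.not_mem_both (hT.ex_mem_of_inst_mem h₁ hy) h).elim
    · exact h₁
    · exact (hT.not_mem_both (hT.inst_mem_of_all_mem hd hy') h₁).elim
  · obtain ⟨z, hz, hm⟩ := hT.witness x _ hd φ.vars
    exact (hT.not_mem_both (hT.ex_mem_of_inst_mem (hT.and_mem.1 hm).2 hz) h).elim

theorem neg_ex_mem_of_neg_inst_mem (hT : IsHenkin δ T) {x : ℕ} (A : Finset ℕ)
    (h : ∀ y ∉ A, .neg (φ.inst x (.var y)) ∈ T) : .neg (.ex x φ) ∈ T := by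
  rcases hT.trichotomy (.ex x φ) with h' | h' | h'
  · obtain ⟨y, hy, hm⟩ := hT.witness x φ h' A
    exact (hT.not_mem_both hm (h y hy)).elim
  · exact h'
  · obtain ⟨y, hy, hn⟩ := hT.exists_neg_inst_mem (hT.neg_or_mem.1 h').1
      (A ∪ {x} ∪ φ.vars ∪ (φ.isdef δ).vars)
    simp only [Finset.mem_union, Finset.mem_singleton, not_or] at hy
    exact (hT.not_mem_both (hT.inst_mem (φ := .neg φ) (.D1 (.neg φ)) (h y hy.1.1.1) hy.1.1.2
      hy.1.2 hy.2) hn).elim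

end IsHenkin

/-! ### Truth values -/

namespace TV

theorem neg_eq_T {v : TV} : v.neg = T ↔ v = F := by cases v <;> simp [neg]

theorem neg_eq_F {v : TV} : v.neg = F ↔ v = T := by cases v <;> simp [neg]

theorem and_eq_T {v w : TV} : v.and w = T ↔ v = T ∧ w = T := by
  cases v <;> cases w <;> simp [and]

theorem and_eq_F {v w : TV} : v.and w = F ↔ v = F ∨ w = F := by
  cases v <;> cases w <;> simp [and]

theorem or_eq_T {v w : TV} : v.or w = T ↔ v = T ∨ w = T := by
  cases v <;> cases w <;> simp [or]

theorem or_eq_F {v w : TV} : v.or w = F ↔ v = F ∧ w = F := by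
  cases v <;> cases w <;> simp [or]

theorem all_eq_T {D : Type} {v : D → TV} : TV.all v = T ↔ ∀ d, v d = T := by
  unfold TV.all; split_ifs <;> simp_all

theorem all_eq_F {D : Type} {v : D → TV} : TV.all v = F ↔ ∃ d, v d = F := by
  unfold TV.all; split_ifs <;> simp_all

theorem ex_eq_T {D : Type} {v : D → TV} : TV.ex v = T ↔ ∃ d, v d = T := by
  unfold TV.ex; split_ifs <;> simp_all

theorem ex_eq_F {D : Type} {v : D → TV} : TV.ex v = F ↔ ∀ d, v d = F := by
  unfold TV.ex; split_ifs <;> simp_all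

theorem eqVal_eq_T {D : Type} {p q : Part D} : eqVal p q = T ↔ ∃ a ∈ p, a ∈ q := by
  unfold eqVal
  split_ifs with h h'
  · exact iff_of_true rfl ⟨_, Part.get_mem h.1, h' ▸ Part.get_mem h.2⟩
  · simp only [false_iff]
    rintro ⟨a, hp, hq⟩
    exact h' ((Part.get_eq_of_mem hp _).trans (Part.get_eq_of_mem hq _).symm)
  · simp only [false_iff]
    rintro ⟨a, hp, hq⟩
    exact h ⟨Part.dom_iff_mem.2 ⟨a, hp⟩, Part.dom_iff_mem.2 ⟨a, hq⟩⟩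

theorem eqVal_eq_F {D : Type} {p q : Part D} : eqVal p q = F ↔ ∃ a ∈ p, ∃ b ∈ q, a ≠ b := by
  unfold eqVal
  split_ifs with h h'
  · simp only [false_iff]
    rintro ⟨a, hp, b, hq, hab⟩
    rw [Part.get_eq_of_mem hp, Part.get_eq_of_mem hq] at h'
    exact hab h'
  · exact iff_of_true rfl ⟨_, Part.get_mem h.1, _, Part.get_mem h.2, h'⟩
  · simp only [false_iff]
    rintro ⟨a, hp, b, hq, -⟩
    exact h ⟨Part.dom_iff_mem.2 ⟨a, hp⟩, Part.dom_iff_mem.2 ⟨b, hq⟩⟩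

theorem memVal_eq_T {D : Type} {p : Part D} {A : Set D} : memVal p A = T ↔ ∃ a ∈ p, a ∈ A := by
  unfold memVal
  split_ifs with h h'
  · exact iff_of_true rfl ⟨_, Part.get_mem h, h'⟩
  · simp only [false_iff]
    rintro ⟨a, hp, ha⟩
    exact h' (Part.get_eq_of_mem hp h ▸ ha)
  · simp only [false_iff]
    rintro ⟨a, hp, -⟩
    exact h (Part.dom_iff_mem.2 ⟨a, hp⟩)

theorem memVal_eq_F {D : Type} {p : Part D} {A : Set D} : memVal p A = F ↔ ∃ a ∈ p, a ∉ A := by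
  unfold memVal
  split_ifs with h h'
  · simp only [false_iff]
    rintro ⟨a, hp, ha⟩
    exact ha (Part.get_eq_of_mem hp h ▸ h')
  · exact iff_of_true rfl ⟨_, Part.get_mem h, h'⟩
  · simp only [false_iff]
    rintro ⟨a, hp, -⟩
    exact h (Part.dom_iff_mem.2 ⟨a, hp⟩)

end TV

theorem mem_tuple {D : Type} {n : ℕ} {p : Fin n → Part D} {a : Fin n → D} :
    a ∈ tuple p ↔ ∀ i, a i ∈ p i := by
  constructor
  · rintro ⟨h, rfl⟩ i
    exact Part.get_mem (h i)
  · intro h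
    exact ⟨fun i => Part.dom_iff_mem.2 ⟨_, h i⟩, funext fun i => Part.get_eq_of_mem (h i) _⟩

/-! ### Evaluation under partial assignments -/

variable {M : Structure L}

/-- The value of a term under an assignment of possibly undefined values. -/
def Term.evalPart (M : Structure L) (ν : ℕ → Part M.D) : Term L → Part M.D
  | .var n => ν n
  | .const c => Part.some (M.const c)
  | .func f ts => (tuple fun i => (ts i).evalPart M ν).bind (M.func f)

/-- The truth value of a formula under an assignment of possibly undefined values. -/
noncomputable def Formula.evalPart (M : Structure L) : (ℕ → Part M.D) → Formula L → TV
  | _, .falsum => .F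
  | _, .verum => .T
  | ν, .eq t₁ t₂ => TV.eqVal (t₁.evalPart M ν) (t₂.evalPart M ν)
  | ν, .rel R ts => TV.memVal (tuple fun i => (ts i).evalPart M ν) (M.rel R)
  | ν, .neg φ => (φ.evalPart M ν).neg
  | ν, .and φ ψ => (φ.evalPart M ν).and (ψ.evalPart M ν)
  | ν, .or φ ψ => (φ.evalPart M ν).or (ψ.evalPart M ν)
  | ν, .all x φ => TV.all fun d => φ.evalPart M (Function.update ν x (Part.some d))
  | ν, .ex x φ => TV.ex fun d => φ.evalPart M (Function.update ν x (Part.some d))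

theorem Term.evalPart_some (ν : ℕ → M.D) (t : Term L) :
    t.evalPart M (fun n => Part.some (ν n)) = t.eval M ν := by
  induction t with
  | var n => rfl
  | const c => rfl
  | func f ts ih => simp only [evalPart, eval, ih]

theorem update_some {D : Type} (ν : ℕ → D) (x : ℕ) (d : D) :
    Function.update (fun n => Part.some (ν n)) x (Part.some d) =
      fun n => Part.some (Function.update ν x d n) := by
  funext n
  by_cases h : n = x
  · simp [h]
  · simp [h]

theorem Formula.evalPart_some (ν : ℕ → M.D) (φ : Formula L) :
    φ.evalPart M (fun n => Part.some (ν n)) = φ.eval M ν := by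
  induction φ generalizing ν with
  | falsum => rfl
  | verum => rfl
  | eq t₁ t₂ => simp only [evalPart, eval, Term.evalPart_some]
  | rel R ts => simp only [evalPart, eval, Term.evalPart_some]
  | neg φ ih => simp only [evalPart, eval, ih]
  | and φ ψ ih₁ ih₂ => simp only [evalPart, eval, ih₁, ih₂]
  | or φ ψ ih₁ ih₂ => simp only [evalPart, eval, ih₁, ih₂]
  | all x φ ih => simp only [evalPart, eval, update_some, ih]
  | ex x φ ih => simp only [evalPart, eval, update_some, ih]

theorem Term.evalPart_congr {ν ν' : ℕ → Part M.D} (t : Term L) (h : ∀ n ∈ t.vars, ν n = ν' n) :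
    t.evalPart M ν = t.evalPart M ν' := by
  induction t with
  | var n => exact h n (by simp [vars])
  | const c => rfl
  | func f ts ih =>
    simp only [evalPart]
    congr 2
    funext i
    exact ih i fun n hn => h n (by simp only [vars, Finset.mem_biUnion]; exact ⟨i, by simp, hn⟩)

theorem update_eq_update {α : Type} {s : Finset ℕ} {ν ν' : ℕ → α} {x : ℕ}
    (h : ∀ n ∈ s.erase x, ν n = ν' n) (a : α) :
    ∀ n ∈ s, Function.update ν x a n = Function.update ν' x a n := by
  intro n hn
  by_cases hx : n = x
  · simp [hx]
  · simpa [hx] using h n (Finset.mem_erase.2 ⟨hx, hn⟩)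

theorem Formula.evalPart_congr {ν ν' : ℕ → Part M.D} (φ : Formula L)
    (h : ∀ n ∈ φ.freeVars, ν n = ν' n) : φ.evalPart M ν = φ.evalPart M ν' := by
  induction φ generalizing ν ν' with
  | falsum => rfl
  | verum => rfl
  | eq t₁ t₂ =>
    simp only [freeVars, Finset.mem_union] at h
    simp only [evalPart, t₁.evalPart_congr fun n hn => h n (.inl hn),
      t₂.evalPart_congr fun n hn => h n (.inr hn)]
  | rel R ts =>
    simp only [evalPart]
    congr 2
    funext i
    exact (ts i).evalPart_congr fun n hn => h n (by
      simp only [freeVars, Finset.mem_biUnion]; exact ⟨i, by simp, hn⟩)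
  | neg φ ih => simp only [evalPart, ih h]
  | and φ ψ ih₁ ih₂ =>
    simp only [freeVars, Finset.mem_union] at h
    simp only [evalPart, ih₁ fun n hn => h n (.inl hn), ih₂ fun n hn => h n (.inr hn)]
  | or φ ψ ih₁ ih₂ =>
    simp only [freeVars, Finset.mem_union] at h
    simp only [evalPart, ih₁ fun n hn => h n (.inl hn), ih₂ fun n hn => h n (.inr hn)]
  | all x φ ih =>
    simp only [evalPart]
    congr 1
    funext d
    exact ih (update_eq_update h _)
  | ex x φ ih =>
    simp only [evalPart]
    congr 1
    funext d
    exact ih (update_eq_update h _)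

theorem Term.eval_congr {ν ν' : ℕ → M.D} (t : Term L) (h : ∀ n ∈ t.vars, ν n = ν' n) :
    t.eval M ν = t.eval M ν' := by
  rw [← evalPart_some, ← evalPart_some]
  exact t.evalPart_congr fun n hn => by rw [h n hn]

theorem Formula.eval_congr {ν ν' : ℕ → M.D} (φ : Formula L) (h : ∀ n ∈ φ.freeVars, ν n = ν' n) :
    φ.eval M ν = φ.eval M ν' := by
  rw [← evalPart_some, ← evalPart_some]
  exact φ.evalPart_congr fun n hn => by rw [h n hn]

theorem Term.evalPart_mono {ν ν' : ℕ → Part M.D} (h : ∀ n, ν n ≤ ν' n) (t : Term L) :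
    t.evalPart M ν ≤ t.evalPart M ν' := by
  induction t with
  | var n => exact h n
  | const c => exact le_rfl
  | func f ts ih =>
    intro a ha
    obtain ⟨b, hb, ha⟩ := Part.mem_bind_iff.1 ha
    exact Part.mem_bind_iff.2 ⟨b, mem_tuple.2 fun i => ih i _ (mem_tuple.1 hb i), ha⟩

/-- Kleene's operations are monotone in the order of information, where U lies below F and T.
Supplying values for undefined variables therefore never changes a classical truth value. -/
theorem Formula.evalPart_mono {ν ν' : ℕ → Part M.D} (h : ∀ n, ν n ≤ ν' n) (φ : Formula L) :
    (φ.evalPart M ν = .T → φ.evalPart M ν' = .T) ∧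
      (φ.evalPart M ν = .F → φ.evalPart M ν' = .F) := by
  have upd : ∀ {ν ν' : ℕ → Part M.D}, (∀ n, ν n ≤ ν' n) → ∀ x (d : M.D) n,
      Function.update ν x (Part.some d) n ≤ Function.update ν' x (Part.some d) n := by
    intro ν ν' h x d n
    by_cases hn : n = x
    · simp [hn]
    · simpa [hn] using h n
  induction φ generalizing ν ν' with
  | falsum => exact ⟨id, id⟩
  | verum => exact ⟨id, id⟩
  | eq t₁ t₂ =>
    simp only [evalPart, TV.eqVal_eq_T, TV.eqVal_eq_F]
    exact ⟨fun ⟨a, h₁, h₂⟩ => ⟨a, t₁.evalPart_mono h _ h₁, t₂.evalPart_mono h _ h₂⟩,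
      fun ⟨a, h₁, b, h₂, hab⟩ => ⟨a, t₁.evalPart_mono h _ h₁, b, t₂.evalPart_mono h _ h₂, hab⟩⟩
  | rel R ts =>
    simp only [evalPart, TV.memVal_eq_T, TV.memVal_eq_F, mem_tuple]
    exact ⟨fun ⟨a, h₁, h₂⟩ => ⟨a, fun i => (ts i).evalPart_mono h _ (h₁ i), h₂⟩,
      fun ⟨a, h₁, h₂⟩ => ⟨a, fun i => (ts i).evalPart_mono h _ (h₁ i), h₂⟩⟩
  | neg φ ih =>
    simp only [evalPart, TV.neg_eq_T, TV.neg_eq_F]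
    exact (ih h).symm
  | and φ ψ ih₁ ih₂ =>
    simp only [evalPart, TV.and_eq_T, TV.and_eq_F]
    exact ⟨And.imp (ih₁ h).1 (ih₂ h).1, Or.imp (ih₁ h).2 (ih₂ h).2⟩
  | or φ ψ ih₁ ih₂ =>
    simp only [evalPart, TV.or_eq_T, TV.or_eq_F]
    exact ⟨Or.imp (ih₁ h).1 (ih₂ h).1, And.imp (ih₁ h).2 (ih₂ h).2⟩
  | all x φ ih =>
    simp only [evalPart, TV.all_eq_T, TV.all_eq_F]
    exact ⟨fun h' d => (ih (upd h x d)).1 (h' d), fun ⟨d, h'⟩ => ⟨d, (ih (upd h x d)).2 h'⟩⟩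
  | ex x φ ih =>
    simp only [evalPart, TV.ex_eq_T, TV.ex_eq_F]
    exact ⟨fun ⟨d, h'⟩ => ⟨d, (ih (upd h x d)).1 h'⟩, fun h' d => (ih (upd h x d)).2 (h' d)⟩

/-! ### Semantics of substitution -/

theorem Term.evalPart_subst (σ : ℕ → Term L) (ν : ℕ → Part M.D) (t : Term L) :
    (t.subst σ).evalPart M ν = t.evalPart M fun n => (σ n).evalPart M ν := by
  induction t with
  | var n => rfl
  | const c => rfl
  | func f ts ih => simp only [subst, evalPart, ih]

theorem evalPart_update_comp {σ : ℕ → Term L} {ν : ℕ → Part M.D} {x y : ℕ} {s : Finset ℕ}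
    (h : ∀ n ∈ s.erase x, y ∉ (σ n).vars) (d : M.D) :
    ∀ n ∈ s, (Function.update σ x (.var y) n).evalPart M (Function.update ν y (Part.some d)) =
      Function.update (fun n => (σ n).evalPart M ν) x (Part.some d) n := by
  intro n hn
  by_cases hx : n = x
  · simp [hx, Term.evalPart]
  · simp only [Function.update_of_ne hx]
    refine (σ n).evalPart_congr fun m hm => Function.update_of_ne ?_ _ _
    rintro rfl
    exact h n (Finset.mem_erase.2 ⟨hx, hn⟩) hm

/-- Either x itself causes no capture, or the new name exceeds every variable of the substituted
terms. -/
theorem Formula.boundName_notMem (σ : ℕ → Term L) (x : ℕ) (φ : Formula L) :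
    ∀ n ∈ φ.freeVars.erase x, boundName σ x φ ∉ (σ n).vars := by
  unfold boundName
  split_ifs with h
  · exact h
  · intro n hn hmem
    have hmem' := Finset.mem_biUnion (t := fun y => (σ y).vars).2 ⟨n, hn, hmem⟩
    have := Finset.le_sup (f := id) (Finset.mem_union_right (insert x φ.vars) hmem')
    simp only [id] at this
    omega

theorem Formula.evalPart_renSubst (σ : ℕ → Term L) (ν : ℕ → Part M.D) (φ : Formula L) :
    (φ.renSubst σ).evalPart M ν = φ.evalPart M fun n => (σ n).evalPart M ν := by
  induction φ generalizing σ ν with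
  | falsum => rfl
  | verum => rfl
  | eq t₁ t₂ => simp only [renSubst, evalPart, Term.evalPart_subst]
  | rel R ts => simp only [renSubst, evalPart, Term.evalPart_subst]
  | neg φ ih => simp only [renSubst, evalPart, ih]
  | and φ ψ ih₁ ih₂ => simp only [renSubst, evalPart, ih₁, ih₂]
  | or φ ψ ih₁ ih₂ => simp only [renSubst, evalPart, ih₁, ih₂]
  | all x φ ih =>
    simp only [renSubst, evalPart, ih]
    congr 1
    funext d
    exact φ.evalPart_congr (evalPart_update_comp (boundName_notMem σ x φ) d)
  | ex x φ ih =>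
    simp only [renSubst, evalPart, ih]
    congr 1
    funext d
    exact φ.evalPart_congr (evalPart_update_comp (boundName_notMem σ x φ) d)

theorem Term.evalPart_update_var (x : ℕ) (t : Term L) (ν : ℕ → Part M.D) :
    (fun n => (Function.update Term.var x t n).evalPart M ν) =
      Function.update ν x (t.evalPart M ν) := by
  funext n
  by_cases h : n = x
  · simp [h]
  · simp [h, evalPart]

theorem Formula.evalPart_inst {x : ℕ} {t : Term L} (ν : ℕ → Part M.D) (φ : Formula L)
    (h : φ.FreeFor t x) :
    (φ.inst x t).evalPart M ν = φ.evalPart M (Function.update ν x (t.evalPart M ν)) := by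
  have quant : ∀ {φ : Formula L} {ν : ℕ → Part M.D} {y : ℕ} (d : M.D),
      (x ∈ φ.freeVars.erase y → y ∉ t.vars ∧ φ.FreeFor t x) →
      (∀ (ν : ℕ → Part M.D), φ.FreeFor t x → (φ.inst x t).evalPart M ν =
        φ.evalPart M (Function.update ν x (t.evalPart M ν))) →
      (φ.subst (Function.update (Function.update Term.var x t) y (.var y))).evalPart M
        (Function.update ν y (Part.some d)) = φ.evalPart M
          (Function.update (Function.update ν x (t.evalPart M ν)) y (Part.some d)) := by
    intro φ ν y d h ih
    by_cases hx : x ∈ φ.freeVars.erase y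
    · obtain ⟨hy, hf⟩ := h hx
      have hne := (Finset.mem_erase.1 hx).1
      rw [Function.update_comm hne, Function.update_eq_self, ← inst, ih _ hf,
        Function.update_comm hne]
      congr 2
      refine t.evalPart_congr fun n hn => Function.update_of_ne ?_ _ _
      rintro rfl
      exact hy hn
    -- No free occurrence of x lies below this quantifier, so the replacement changes nothing and
    -- the value given to x is irrelevant.
    · rw [φ.subst_congr (τ := Term.var), subst_var]
      · refine φ.evalPart_congr (update_eq_update (fun n hn => ?_) _)
        rw [Function.update_of_ne]
        rintro rfl
        exact hx hn
      · intro n hn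
        by_cases hny : n = y
        · simp [hny]
        · rw [Function.update_of_ne hny, Function.update_of_ne]
          rintro rfl
          exact hx (Finset.mem_erase.2 ⟨hny, hn⟩)
  induction φ generalizing ν with
  | falsum => rfl
  | verum => rfl
  | eq t₁ t₂ => simp only [inst, subst, evalPart, Term.evalPart_subst, Term.evalPart_update_var]
  | rel R ts => simp only [inst, subst, evalPart, Term.evalPart_subst, Term.evalPart_update_var]
  | neg φ ih =>
    have := ih ν h
    simp only [inst] at this
    simp only [inst, subst, evalPart, this]
  | and φ ψ ih₁ ih₂ =>
    have h₁ := ih₁ ν h.1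
    have h₂ := ih₂ ν h.2
    simp only [inst] at h₁ h₂
    simp only [inst, subst, evalPart, h₁, h₂]
  | or φ ψ ih₁ ih₂ =>
    have h₁ := ih₁ ν h.1
    have h₂ := ih₂ ν h.2
    simp only [inst] at h₁ h₂
    simp only [inst, subst, evalPart, h₁, h₂]
  | all y φ ih =>
    simp only [inst, subst, evalPart]
    exact congrArg TV.all (funext fun d => quant d h ih)
  | ex y φ ih =>
    simp only [inst, subst, evalPart]
    exact congrArg TV.ex (funext fun d => quant d h ih)

theorem Formula.eval_inst_of_mem {x : ℕ} {t : Term L} {ν : ℕ → M.D} {φ : Formula L} {d : M.D}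
    (h : φ.FreeFor t x) (hd : d ∈ t.eval M ν) :
    (φ.inst x t).eval M ν = φ.eval M (Function.update ν x d) := by
  rw [← evalPart_some, evalPart_inst _ _ h, Term.evalPart_some, Part.eq_some_iff.2 hd, update_some,
    evalPart_some]

theorem Formula.eval_inst_var {x y : ℕ} {ν : ℕ → M.D} {φ : Formula L} (h : φ.FreeFor (.var y) x) :
    (φ.inst x (.var y)).eval M ν = φ.eval M (Function.update ν x (ν y)) :=
  eval_inst_of_mem h (Part.mem_some _)

/-- This is soundness of ∃I, where t need not be defined: φ(t) can be true through parts that do not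
depend on t. In that case φ is true with x undefined and, by monotonicity, at every element of the
non-empty domain. -/
theorem Formula.exists_eval_of_eval_inst {x : ℕ} {t : Term L} {ν : ℕ → M.D} {φ : Formula L}
    (h : φ.FreeFor t x) (hT : (φ.inst x t).eval M ν = .T) :
    ∃ d, φ.eval M (Function.update ν x d) = .T := by
  by_cases ht : (t.eval M ν).Dom
  · exact ⟨_, by rwa [← eval_inst_of_mem h (Part.get_mem ht)]⟩
  · obtain ⟨d⟩ := M.nonempty
    refine ⟨d, ?_⟩
    rw [← evalPart_some, evalPart_inst _ _ h, Term.evalPart_some, Part.eq_none_iff'.2 ht] at hT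
    rw [← evalPart_some, ← update_some]
    refine (evalPart_mono (fun n => ?_) φ).1 hT
    by_cases hn : n = x
    · subst hn
      rw [Function.update_self]
      exact fun a ha => (Part.notMem_none a ha).elim
    · simp [hn]

theorem Term.eval_subst_update_congr {σ : ℕ → Term L} {ν : ℕ → M.D} {i : ℕ} {t t' : Term L}
    (h : t.eval M ν = t'.eval M ν) (s : Term L) :
    (s.subst (Function.update σ i t)).eval M ν = (s.subst (Function.update σ i t')).eval M ν := by
  simp only [← evalPart_some, evalPart_subst]
  refine s.evalPart_congr fun n _ => ?_
  by_cases hn : n = i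
  · simpa [hn, evalPart_some] using h
  · simp [hn]

theorem Formula.eval_subst_update_congr {σ : ℕ → Term L} {ν : ℕ → M.D} {i : ℕ} {t t' : Term L}
    (h : t.eval M ν = t'.eval M ν) (φ : Formula L) (ht : φ.FreeFor t i) (ht' : φ.FreeFor t' i) :
    (φ.subst (Function.update σ i t)).eval M ν = (φ.subst (Function.update σ i t')).eval M ν := by
  have quant : ∀ {φ : Formula L} {σ : ℕ → Term L} {ν : ℕ → M.D} {y : ℕ} (d : M.D),
      t.eval M ν = t'.eval M ν →
      (i ∈ φ.freeVars.erase y → y ∉ t.vars ∧ φ.FreeFor t i) →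
      (i ∈ φ.freeVars.erase y → y ∉ t'.vars ∧ φ.FreeFor t' i) →
      (∀ {σ : ℕ → Term L} {ν : ℕ → M.D}, t.eval M ν = t'.eval M ν →
        φ.FreeFor t i → φ.FreeFor t' i →
        (φ.subst (Function.update σ i t)).eval M ν = (φ.subst (Function.update σ i t')).eval M ν) →
      (φ.subst (Function.update (Function.update σ i t) y (.var y))).eval M (Function.update ν y d) =
      (φ.subst (Function.update (Function.update σ i t') y (.var y))).eval M
        (Function.update ν y d) := by
    intro φ σ ν y d h ht ht' ih
    by_cases hi : i ∈ φ.freeVars.erase y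
    · have hne := (Finset.mem_erase.1 hi).1
      have fresh : ∀ {t : Term L}, y ∉ t.vars → t.eval M (Function.update ν y d) = t.eval M ν := by
        intro t hy
        refine t.eval_congr fun n hn => Function.update_of_ne ?_ _ _
        rintro rfl
        exact hy hn
      -- The bound variable y occurs in neither t nor t', so their values still agree after y is
      -- reassigned.
      rw [Function.update_comm hne, Function.update_comm hne]
      exact ih (by rw [fresh (ht hi).1, fresh (ht' hi).1, h]) (ht hi).2 (ht' hi).2
    · rw [φ.subst_congr (update_eq_update (fun n hn => ?_) _)]
      have : n ≠ i := by
        rintro rfl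
        exact hi hn
      rw [Function.update_of_ne this, Function.update_of_ne this]
  induction φ generalizing σ ν with
  | falsum => rfl
  | verum => rfl
  | eq t₁ t₂ => simp only [subst, eval, Term.eval_subst_update_congr h]
  | rel R ts => simp only [subst, eval, Term.eval_subst_update_congr h]
  | neg φ ih => simp only [subst, eval, ih h ht ht']
  | and φ ψ ih₁ ih₂ => simp only [subst, eval, ih₁ h ht.1 ht'.1, ih₂ h ht.2 ht'.2]
  | or φ ψ ih₁ ih₂ => simp only [subst, eval, ih₁ h ht.1 ht'.1, ih₂ h ht.2 ht'.2]
  | all y φ ih =>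
    simp only [subst, eval]
    exact congrArg TV.all (funext fun d => quant d h ht ht' ih)
  | ex y φ ih =>
    simp only [subst, eval]
    exact congrArg TV.ex (funext fun d => quant d h ht ht' ih)

/-! ### Semantics of isdef-formulas -/

theorem Term.eval_dom_of_total {t : Term L} (h : ∀ g ∈ t.funcs, ∀ a, (M.func g a).Dom)
    (ν : ℕ → M.D) : (t.eval M ν).Dom := by
  induction t with
  | var n => trivial
  | const c => trivial
  | func f ts ih =>
    have hd : (tuple fun i => (ts i).eval M ν).Dom := fun i => ih i fun g hg =>
      h g (.inr (Set.mem_iUnion.2 ⟨i, hg⟩))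
    exact Part.dom_iff_mem.2 ⟨_, Part.mem_bind (Part.get_mem hd)
      (Part.get_mem (h f (.inl rfl) _))⟩

theorem Formula.eval_eq_T_or_F_of_total {φ : Formula L}
    (h : ∀ g ∈ φ.funcs, ∀ a, (M.func g a).Dom) (ν : ℕ → M.D) :
    φ.eval M ν = .T ∨ φ.eval M ν = .F := by
  induction φ generalizing ν with
  | falsum => exact .inr rfl
  | verum => exact .inl rfl
  | eq t₁ t₂ =>
    have h₁ := Term.eval_dom_of_total (t := t₁) (fun g hg => h g (.inl hg)) ν
    have h₂ := Term.eval_dom_of_total (t := t₂) (fun g hg => h g (.inr hg)) ν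
    simp only [eval, TV.eqVal, h₁, h₂, and_self, dite_true]
    split_ifs <;> simp
  | rel R ts =>
    have hd : (tuple fun i => (ts i).eval M ν).Dom := fun i =>
      Term.eval_dom_of_total (fun g hg => h g (Set.mem_iUnion.2 ⟨i, hg⟩)) ν
    simp only [eval, TV.memVal, hd, dite_true]
    split_ifs <;> simp
  | neg φ ih =>
    simp only [eval, TV.neg_eq_T, TV.neg_eq_F]
    exact (ih h ν).symm
  | and φ ψ ih₁ ih₂ =>
    have h₁ := ih₁ (fun g hg => h g (.inl hg)) ν
    have h₂ := ih₂ (fun g hg => h g (.inr hg)) ν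
    simp only [eval, TV.and_eq_T, TV.and_eq_F]
    tauto
  | or φ ψ ih₁ ih₂ =>
    have h₁ := ih₁ (fun g hg => h g (.inl hg)) ν
    have h₂ := ih₂ (fun g hg => h g (.inr hg)) ν
    simp only [eval, TV.or_eq_T, TV.or_eq_F]
    tauto
  | all x φ ih =>
    simp only [eval, TV.all_eq_T, TV.all_eq_F]
    refine or_iff_not_imp_right.2 fun hn d => (ih h _).resolve_right fun hd => hn ⟨d, hd⟩
  | ex x φ ih =>
    simp only [eval, TV.ex_eq_T, TV.ex_eq_F]
    refine or_iff_not_imp_left.2 fun hn d => (ih h _).resolve_left fun hd => hn ⟨d, hd⟩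

theorem Formula.eval_conj {ν : ℕ → M.D} (l : List (Formula L)) :
    ((conj l).eval M ν = .T ↔ ∀ φ ∈ l, φ.eval M ν = .T) ∧
      ((conj l).eval M ν = .F ↔ ∃ φ ∈ l, φ.eval M ν = .F) := by
  have key : ∀ (l : List (Formula L)) (φ : Formula L),
      ((l.foldl .and φ).eval M ν = .T ↔ φ.eval M ν = .T ∧ ∀ φ ∈ l, φ.eval M ν = .T) ∧
      ((l.foldl .and φ).eval M ν = .F ↔ φ.eval M ν = .F ∨ ∃ φ ∈ l, φ.eval M ν = .F) := by
    intro l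
    induction l with
    | nil => simp
    | cons ψ l ih => intro φ; simp [ih, eval, TV.and_eq_T, TV.and_eq_F, and_assoc, or_assoc]
  cases l with
  | nil => simp [conj, eval]
  | cons φ l => simp [conj, key]

variable {δ : IsdefFormulas L}

theorem Structure.ModelsIsdef.total (hM : M.ModelsIsdef δ) {f g : L.Func}
    (hg : g ∈ (δ.isdef f).funcs) (a : Fin (L.funcArity g) → M.D) : (M.func g a).Dom := by
  obtain ⟨d⟩ := M.nonempty
  have := (hM g fun n => if h : n < L.funcArity g then a ⟨n, h⟩ else d).1
    (by rw [δ.funcs_total f g hg]; rfl)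
  simpa using this

/-- The formula ⌈t⌉ is never undefined: ⌈f⌉ contains only functions that are total in a model of the
isdef-formulas, and if an argument is undefined, its own conjunct is false and makes the whole
conjunction false. -/
theorem Term.eval_isdef (hM : M.ModelsIsdef δ) (ν : ℕ → M.D) (t : Term L) :
    ((t.isdef δ).eval M ν = .T ↔ (t.eval M ν).Dom) ∧
      ((t.isdef δ).eval M ν = .F ↔ ¬ (t.eval M ν).Dom) := by
  induction t with
  | var n => simp [isdef, eval, Formula.eval]
  | const c => simp [isdef, eval, Formula.eval]
  | func f ts ih =>
    by_cases hd : ∀ i, ((ts i).eval M ν).Dom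
    · have hd' : ∀ i, ((ts i).isdef δ).eval M ν = .T := fun i => (ih i).1.2 (hd i)
      obtain ⟨d⟩ := M.nonempty
      let ν' : ℕ → M.D := fun n => if h : n < L.funcArity f then
        ((ts ⟨n, h⟩).eval M ν).get (hd _) else d
      have e₁ : ((δ.isdef f).renSubst (argSubst ts)).eval M ν = (δ.isdef f).eval M ν' := by
        rw [← Formula.evalPart_some, Formula.evalPart_renSubst, ← Formula.evalPart_some]
        refine (δ.isdef f).evalPart_congr fun n hn => ?_
        have := δ.freeVars_lt f n hn
        simp [argSubst, ν', this, Term.evalPart_some]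
      have e₂ : (fun i : Fin (L.funcArity f) => ν' i) = fun i => ((ts i).eval M ν).get (hd i) := by
        funext i
        simp [ν']
      have e₃ : ((Term.func f ts).eval M ν).Dom ↔ (M.func f fun i => ν' i).Dom := by
        rw [e₂]
        exact ⟨fun h => h.2, fun h => ⟨hd, h⟩⟩
      have e₄ := Formula.eval_eq_T_or_F_of_total (fun g hg => hM.total hg) ν' (φ := δ.isdef f)
      rw [e₃, ← hM f ν', isdef, (Formula.eval_conj _).1, (Formula.eval_conj _).2, ← e₁]
      rw [← e₁] at e₄
      simp only [List.mem_append, List.mem_ofFn, List.mem_singleton]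
      constructor
      · constructor
        · exact fun h => h _ (.inr rfl)
        · rintro h φ (⟨i, rfl⟩ | rfl)
          · exact hd' i
          · exact h
      · constructor
        · rintro ⟨φ, (⟨i, rfl⟩ | rfl), h⟩
          · simp [hd' i] at h
          · simp [h]
        · exact fun h => ⟨_, .inr rfl, e₄.resolve_left h⟩
    · have e : ¬ ((Term.func f ts).eval M ν).Dom := fun h => hd h.1
      rw [not_forall] at hd
      obtain ⟨i, hi⟩ := hd
      have : ((Term.func f ts).isdef δ).eval M ν = .F := by
        rw [isdef, (Formula.eval_conj _).2]
        exact ⟨_, List.mem_append_left _ (List.mem_ofFn.2 ⟨i, rfl⟩), (ih i).2.2 hi⟩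
      simp [this, e]

theorem Formula.eval_isdef (hM : M.ModelsIsdef δ) (ν : ℕ → M.D) (φ : Formula L) :
    ((φ.isdef δ).eval M ν = .T ↔ φ.eval M ν = .T ∨ φ.eval M ν = .F) ∧
      ((φ.isdef δ).eval M ν = .F ↔ ¬ (φ.eval M ν = .T ∨ φ.eval M ν = .F)) := by
  have hT := fun (t : Term L) ν => (t.eval_isdef hM ν).1
  have hF := fun (t : Term L) ν => (t.eval_isdef hM ν).2
  induction φ generalizing ν with
  | falsum => simp [isdef, eval]
  | verum => simp [isdef, eval]
  | eq t₁ t₂ =>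
    simp only [isdef, eval, TV.and_eq_T, TV.and_eq_F, hT, hF, TV.eqVal]
    split_ifs <;> simp_all
    tauto
  | rel R ts =>
    have e : (tuple fun i => (ts i).eval M ν).Dom ↔ ∀ i, ((ts i).eval M ν).Dom := Iff.rfl
    simp only [isdef, eval, eval_conj, List.mem_ofFn, forall_exists_index, forall_apply_eq_imp_iff,
      exists_exists_eq_and, hT, hF, TV.memVal]
    rw [← e, ← not_forall, ← e]
    split_ifs <;> simp_all
  | neg φ ih =>
    simp only [isdef, eval, TV.neg_eq_T, TV.neg_eq_F, (ih ν).1, (ih ν).2]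
    tauto
  | and φ ψ ih₁ ih₂ =>
    simp only [isdef, eval, TV.and_eq_T, TV.and_eq_F, TV.or_eq_T, TV.or_eq_F, TV.neg_eq_T,
      TV.neg_eq_F, ih₁, ih₂]
    cases φ.eval M ν <;> cases ψ.eval M ν <;> simp
  | or φ ψ ih₁ ih₂ =>
    simp only [isdef, eval, TV.and_eq_T, TV.and_eq_F, TV.or_eq_T, TV.or_eq_F, ih₁, ih₂]
    cases φ.eval M ν <;> cases ψ.eval M ν <;> simp
  | all x φ ih =>
    simp only [isdef, eval, TV.and_eq_T, TV.and_eq_F, TV.or_eq_T, TV.or_eq_F, TV.neg_eq_T,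
      TV.neg_eq_F, TV.all_eq_T, TV.all_eq_F, TV.ex_eq_T, TV.ex_eq_F, ih]
    grind
  | ex x φ ih =>
    simp only [isdef, eval, TV.and_eq_T, TV.and_eq_F, TV.or_eq_T, TV.or_eq_F, TV.all_eq_T,
      TV.all_eq_F, TV.ex_eq_T, TV.ex_eq_F, ih]
    grind

/-! ### Soundness -/

theorem Proves.sound {Γ : Set (Formula L)} {φ : Formula L} (h : Proves δ Γ φ) :
    Entails δ Γ φ := by
  have fresh : ∀ {M : Structure L} {ν : ℕ → M.D} {φ : Formula L} {y : ℕ} (d : M.D),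
      y ∉ φ.freeVars → φ.eval M (Function.update ν y d) = φ.eval M ν := by
    intro M ν φ y d hy
    refine φ.eval_congr fun n hn => Function.update_of_ne ?_ _ _
    rintro rfl
    exact hy hn
  induction h with
  | P1 φ => exact fun M ν h => h.2 φ rfl
  | P2 Γ Δ φ _ ih => exact fun M ν h => ih M ν ⟨h.1, fun ψ hψ => h.2 ψ (.inl hψ)⟩
  | P3 Γ φ ψ _ _ ih₁ ih₂ =>
    refine fun M ν h => ih₂ M ν ⟨h.1, ?_⟩
    rintro θ (hθ | rfl)
    · exact h.2 θ hθ
    · exact ih₁ M ν h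
  | C1 φ =>
    intro M ν h
    simp only [Formula.eval, TV.or_eq_T, TV.neg_eq_T, (Formula.eval_isdef h.1 ν φ).2]
    tauto
  | C2 φ => exact fun M ν h => nomatch h.2 _ rfl
  | C3 φ =>
    intro M ν h
    have h₁ := h.2 φ (.inl rfl)
    have h₂ := h.2 _ (.inr rfl)
    simp [Formula.eval, h₁, TV.neg] at h₂
  | D1 φ => exact fun M ν h => (φ.eval_isdef h.1 ν).1.2 (.inl (h.2 φ rfl))
  | andI φ ψ =>
    exact fun M ν h => TV.and_eq_T.2 ⟨h.2 φ (.inl rfl), h.2 ψ (.inr rfl)⟩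
  | andE1 φ ψ => exact fun M ν h => (TV.and_eq_T.1 (h.2 _ rfl)).1
  | andE2 φ ψ => exact fun M ν h => (TV.and_eq_T.1 (h.2 _ rfl)).2
  | orI1 φ ψ => exact fun M ν h => TV.or_eq_T.2 (.inl (h.2 _ rfl))
  | orI2 φ ψ => exact fun M ν h => TV.or_eq_T.2 (.inr (h.2 _ rfl))
  | orE Γ φ ψ χ _ _ ih₁ ih₂ =>
    intro M ν h
    rcases TV.or_eq_T.1 (h.2 _ (.inr rfl)) with h' | h'
    · refine ih₁ M ν ⟨h.1, ?_⟩
      rintro θ (hθ | rfl)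
      · exact h.2 θ (.inl hθ)
      · exact h'
    · refine ih₂ M ν ⟨h.1, ?_⟩
      rintro θ (hθ | rfl)
      · exact h.2 θ (.inl hθ)
      · exact h'
  | eq1 t =>
    intro M ν h
    have := Part.get_mem ((t.eval_isdef h.1 ν).1.1 (h.2 _ rfl))
    exact TV.eqVal_eq_T.2 ⟨_, this, this⟩
  | eq2 φ σ i t t' h h' =>
    intro M ν hM
    obtain ⟨a, ha, ha'⟩ := TV.eqVal_eq_T.1 (hM.2 _ (.inl rfl))
    rw [← φ.eval_subst_update_congr ((Part.eq_some_iff.2 ha).trans (Part.eq_some_iff.2 ha').symm)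
      h h']
    exact hM.2 _ (.inr rfl)
  | allE φ x t h =>
    intro M ν hM
    have := Part.get_mem ((t.eval_isdef hM.1 ν).1.1 (hM.2 _ (.inl rfl)))
    rw [Formula.eval_inst_of_mem h this]
    exact TV.all_eq_T.1 (hM.2 _ (.inr rfl)) _
  | allI Γ φ x _ hx ih =>
    refine fun M ν h => TV.all_eq_T.2 fun d => ih M _ ⟨h.1, fun ψ hψ => ?_⟩
    rw [fresh d (hx ψ hψ)]
    exact h.2 ψ hψ
  | exI φ x t h =>
    exact fun M ν hM => TV.ex_eq_T.2 (Formula.exists_eval_of_eval_inst h (hM.2 _ rfl))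
  | exE Γ φ ψ x y _ hΓ hφ hψ ih =>
    intro M ν hM
    obtain ⟨d, hd⟩ := TV.ex_eq_T.1 (hM.2 _ (.inr rfl))
    simp only [Formula.vars, Finset.mem_insert, not_or] at hφ
    rw [← fresh d fun h => hψ (ψ.freeVars_subset_vars h)]
    refine ih M _ ⟨hM.1, ?_⟩
    rintro θ (hθ | rfl)
    · rw [fresh d fun h => hΓ θ hθ (θ.freeVars_subset_vars h)]
      exact hM.2 θ (.inl hθ)
    · rw [Formula.eval_inst_var (Formula.freeFor_of_notMem_vars x hφ.2), Function.update_self,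
        Function.update_comm hφ.1, fresh d fun h => hφ.2 (φ.freeVars_subset_vars h)]
      exact hd

/-! ### The canonical model of a Henkin theory -/

namespace IsHenkin

variable {T : Set (Formula L)}

theorem exists_eq_var_mem (hT : IsHenkin δ T) {t : Term L} (h : t.isdef δ ∈ T) (A : Finset ℕ) :
    ∃ z ∉ A, .eq t (.var z) ∈ T := by
  obtain ⟨x, hx⟩ := Infinite.exists_notMem_finset t.vars
  obtain ⟨z, hz, hm⟩ := hT.witness x _ (hT.mem_of_proves (.exists_eq hx (.of_mem h))) A
  have : t.subst (Function.update Term.var x (.var z)) = t := by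
    conv_rhs => rw [← t.subst_var]
    refine t.subst_congr fun n hn => Function.update_of_ne ?_ _ _
    rintro rfl
    exact hx hn
  exact ⟨z, hz, by simpa [Formula.inst, Formula.subst, Term.subst, this] using hm⟩

theorem verum_mem (hT : IsHenkin δ T) : .verum ∈ T := hT.mem_of_proves .verum

theorem eq_symm (hT : IsHenkin δ T) {t t' : Term L} (h : .eq t t' ∈ T) : .eq t' t ∈ T :=
  hT.mem_of_proves (.eqSymm (.of_mem h))

theorem eq_trans (hT : IsHenkin δ T) {t t' t'' : Term L} (h : .eq t t' ∈ T)
    (h' : .eq t' t'' ∈ T) : .eq t t'' ∈ T :=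
  hT.mem_of_proves (.eqTrans (.of_mem h) (.of_mem h'))

/-- Variables are identified if the theory says that they are equal. -/
def setoid (hT : IsHenkin δ T) : Setoid ℕ where
  r x y := .eq (.var x) (.var y) ∈ T
  iseqv := ⟨fun x => hT.mem_of_proves (.eqRefl_var x), hT.eq_symm, hT.eq_trans⟩

/-- The canonical model: its elements are the variables up to provable equality. -/
noncomputable def canonical (hT : IsHenkin δ T) : Structure L where
  D := Quotient hT.setoid
  nonempty := ⟨Quotient.mk _ 0⟩
  const c := Quotient.mk _ (hT.exists_eq_var_mem (t := .const c) hT.verum_mem ∅).choose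
  -- Chosen representatives define functions and relations without well-definedness proofs; the
  -- passage to other representatives is made by `Proves.func_congr` and `Proves.rel_congr` when
  -- terms and atoms are evaluated.
  func f d := ⟨∃ z, .eq (.func f fun i => .var (d i).out) (.var z) ∈ T,
    fun h => Quotient.mk _ h.choose⟩
  rel R := {d | .rel R (fun i => .var (d i).out) ∈ T}

/-- The assignment of its class to each variable. -/
def classOf (hT : IsHenkin δ T) : ℕ → hT.canonical.D := Quotient.mk hT.setoid

variable (hT : IsHenkin δ T)

theorem classOf_eq_iff {x y : ℕ} : hT.classOf x = hT.classOf y ↔ .eq (.var x) (.var y) ∈ T :=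
  Quotient.eq (r := hT.setoid)

theorem classOf_out (d : hT.canonical.D) : hT.classOf (Quotient.out (s := hT.setoid) d) = d :=
  Quotient.out_eq (s := hT.setoid) d

/-- Each class has members outside any finite set, because ∃x (v = x) has witnesses there. Hence
every element of the domain can be named by a variable that no quantifier of a given formula
captures. -/
theorem exists_classOf_eq (d : hT.canonical.D) (A : Finset ℕ) : ∃ y ∉ A, hT.classOf y = d := by
  obtain ⟨z, hz, h⟩ := hT.exists_eq_var_mem (t := .var (Quotient.out (s := hT.setoid) d))
    hT.verum_mem A
  exact ⟨z, hz, by rw [← hT.classOf_eq_iff.2 h, hT.classOf_out]⟩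

theorem classOf_mem_eval (t : Term L) (z : ℕ) :
    hT.classOf z ∈ t.eval hT.canonical hT.classOf ↔ .eq t (.var z) ∈ T := by
  induction t generalizing z with
  | var n =>
    rw [Term.eval, Part.mem_some_iff, hT.classOf_eq_iff]
    exact ⟨hT.eq_symm, hT.eq_symm⟩
  | const c =>
    have h := (hT.exists_eq_var_mem (t := .const c) hT.verum_mem ∅).choose_spec.2
    rw [Term.eval, Part.mem_some_iff]
    refine hT.classOf_eq_iff.trans ⟨fun h' => hT.eq_trans h (hT.eq_symm h'),
      fun h' => hT.eq_trans (hT.eq_symm h') h⟩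
  | func f ts ih =>
    refine Part.mem_bind_iff.trans ⟨?_, ?_⟩
    · rintro ⟨a, ha, hd, hz⟩
      have hz' := hT.eq_trans hd.choose_spec (hT.classOf_eq_iff.1 hz)
      refine hT.mem_of_proves (.func_congr (fun i => .of_mem (hT.eq_symm ?_)) (.of_mem hz'))
      rw [← ih, hT.classOf_out]
      exact mem_tuple.1 ha i
    · intro h
      have hd : (Term.func f ts).isdef δ ∈ T := hT.mem_of_proves (.eqLeft (.of_mem h))
      rw [Term.isdef, hT.conj_mem] at hd
      have hy := fun i => hT.exists_eq_var_mem
        (hd _ (List.mem_append_left _ (List.mem_ofFn.2 ⟨i, rfl⟩))) ∅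
      choose y _ hy using hy
      refine ⟨fun i => hT.classOf (y i), mem_tuple.2 fun i => (ih i _).2 (hy i), ?_⟩
      have hm : Formula.eq (.func f fun i => .var (Quotient.out (s := hT.setoid)
          (hT.classOf (y i)))) (.var z) ∈ T := by
        refine hT.mem_of_proves (.func_congr (fun i => .of_mem (hT.eq_trans (hy i) ?_)) (.of_mem h))
        rw [← hT.classOf_eq_iff, hT.classOf_out]
      have hd : ((hT.canonical).func f fun i => hT.classOf (y i)).Dom := ⟨z, hm⟩
      exact ⟨hd, hT.classOf_eq_iff.2 (hT.eq_trans (hT.eq_symm hd.choose_spec) hm)⟩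

theorem exists_mem_eval_of_isdef_mem {t : Term L} (h : t.isdef δ ∈ T) :
    ∃ z, hT.classOf z ∈ t.eval hT.canonical hT.classOf ∧ .eq t (.var z) ∈ T := by
  obtain ⟨z, -, hz⟩ := hT.exists_eq_var_mem h ∅
  exact ⟨z, (hT.classOf_mem_eval t z).2 hz, hz⟩

theorem eq_out_mem_of_mem_eval {t : Term L} {d : hT.canonical.D}
    (h : d ∈ t.eval hT.canonical hT.classOf) :
    .eq t (.var (Quotient.out (s := hT.setoid) d)) ∈ T := by
  rwa [← hT.classOf_mem_eval, hT.classOf_out]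

theorem isdef_mem_of_mem_eval {t : Term L} {d : hT.canonical.D}
    (h : d ∈ t.eval hT.canonical hT.classOf) : t.isdef δ ∈ T :=
  hT.mem_of_proves (.eqLeft (.of_mem (hT.eq_out_mem_of_mem_eval h)))

theorem eval_eq (t₁ t₂ : Term L) :
    ((Formula.eq t₁ t₂).eval hT.canonical hT.classOf = .T ↔ .eq t₁ t₂ ∈ T) ∧
      ((Formula.eq t₁ t₂).eval hT.canonical hT.classOf = .F ↔ .neg (.eq t₁ t₂) ∈ T) := by
  have hiff : (Formula.eq t₁ t₂).eval hT.canonical hT.classOf = .T ↔ .eq t₁ t₂ ∈ T := by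
    rw [Formula.eval, TV.eqVal_eq_T]
    constructor
    · rintro ⟨a, h₁, h₂⟩
      exact hT.eq_trans (hT.eq_out_mem_of_mem_eval h₁) (hT.eq_symm (hT.eq_out_mem_of_mem_eval h₂))
    · intro h
      obtain ⟨z, hz, hm⟩ := hT.exists_mem_eval_of_isdef_mem (hT.and_mem.1 (hT.isdef_mem h)).1
      exact ⟨_, hz, (hT.classOf_mem_eval _ _).2 (hT.eq_trans (hT.eq_symm h) hm)⟩
  refine ⟨hiff, ?_⟩
  constructor
  · intro h
    refine (hT.neg_mem_of_isdef ?_).2 fun h' => by simp [hiff.2 h'] at h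
    rw [Formula.eval, TV.eqVal_eq_F] at h
    obtain ⟨a, h₁, b, h₂, -⟩ := h
    exact hT.and_mem.2 ⟨hT.isdef_mem_of_mem_eval h₁, hT.isdef_mem_of_mem_eval h₂⟩
  · intro h
    have hd := hT.and_mem.1 (hT.isdef_mem_of_neg h)
    obtain ⟨z₁, h₁, -⟩ := hT.exists_mem_eval_of_isdef_mem hd.1
    obtain ⟨z₂, h₂, -⟩ := hT.exists_mem_eval_of_isdef_mem hd.2
    refine TV.eqVal_eq_F.2 ⟨_, h₁, _, h₂, fun e => ?_⟩
    exact hT.not_mem_both (hiff.1 (TV.eqVal_eq_T.2 ⟨_, h₁, e ▸ h₂⟩)) h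

theorem eval_rel (R : L.Rel) (ts : Fin (L.relArity R) → Term L) :
    ((Formula.rel R ts).eval hT.canonical hT.classOf = .T ↔ .rel R ts ∈ T) ∧
      ((Formula.rel R ts).eval hT.canonical hT.classOf = .F ↔ .neg (.rel R ts) ∈ T) := by
  have hmem : ∀ a ∈ tuple (fun i => (ts i).eval hT.canonical hT.classOf),
      a ∈ hT.canonical.rel R ↔ .rel R ts ∈ T := by
    intro a ha
    have h := fun i => hT.eq_out_mem_of_mem_eval (mem_tuple.1 ha i)
    exact ⟨fun h' => hT.mem_of_proves (.rel_congr (fun i => .of_mem (hT.eq_symm (h i)))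
      (.of_mem h')), fun h' => hT.mem_of_proves (.rel_congr (fun i => .of_mem (h i)) (.of_mem h'))⟩
  have hdef : (Formula.rel R ts).isdef δ ∈ T ↔
      ∃ a, a ∈ tuple (fun i => (ts i).eval hT.canonical hT.classOf) := by
    rw [Formula.isdef, hT.conj_mem]
    constructor
    · intro h
      choose z hz _ using fun i => hT.exists_mem_eval_of_isdef_mem (h _ (List.mem_ofFn.2 ⟨i, rfl⟩))
      exact ⟨_, mem_tuple.2 hz⟩
    · rintro ⟨a, ha⟩ φ hφ
      obtain ⟨i, rfl⟩ := List.mem_ofFn.1 hφ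
      exact hT.isdef_mem_of_mem_eval (mem_tuple.1 ha i)
  rw [Formula.eval, TV.memVal_eq_T, TV.memVal_eq_F]
  constructor
  · constructor
    · rintro ⟨a, ha, h⟩
      exact (hmem a ha).1 h
    · intro h
      obtain ⟨a, ha⟩ := hdef.1 (hT.isdef_mem h)
      exact ⟨a, ha, (hmem a ha).2 h⟩
  · constructor
    · rintro ⟨a, ha, h⟩
      rw [hT.neg_mem_of_isdef (hdef.2 ⟨a, ha⟩), ← hmem a ha]
      exact h
    · intro h
      obtain ⟨a, ha⟩ := hdef.1 (hT.isdef_mem_of_neg h)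
      exact ⟨a, ha, fun h' => hT.not_mem_both ((hmem a ha).1 h') h⟩

theorem eval_canonical (φ : Formula L) :
    (φ.eval hT.canonical hT.classOf = .T ↔ φ ∈ T) ∧
      (φ.eval hT.canonical hT.classOf = .F ↔ .neg φ ∈ T) := by
  -- The quantifier cases need φ(y), which is not a subformula but has the depth of φ.
  induction hn : φ.depth using Nat.strong_induction_on generalizing φ with
  | _ n ih =>
  subst hn
  have inst : ∀ (φ : Formula L) (x y : ℕ), y ∉ φ.vars →
      φ.eval hT.canonical (Function.update hT.classOf x (hT.classOf y)) =
        (φ.inst x (.var y)).eval hT.canonical hT.classOf := fun φ x y hy =>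
    (Formula.eval_inst_var (Formula.freeFor_of_notMem_vars x hy)).symm
  have hfalsum : .falsum ∉ T := fun h => hT.consistent (.of_mem h)
  cases φ with
  | falsum =>
    refine ⟨iff_of_false nofun hfalsum, iff_of_true rfl ?_⟩
    exact (hT.neg_mem_of_isdef (φ := .falsum) hT.verum_mem).2 hfalsum
  | verum => exact ⟨iff_of_true rfl hT.verum_mem, iff_of_false nofun (hT.not_mem_both hT.verum_mem)⟩
  | eq t₁ t₂ => exact hT.eval_eq t₁ t₂
  | rel R ts => exact hT.eval_rel R ts
  | neg φ =>
    have h := ih _ (by simp [Formula.depth]) φ rfl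
    simp only [Formula.eval, TV.neg_eq_T, TV.neg_eq_F, h, hT.neg_neg_mem, and_self]
  | and φ ψ =>
    have h₁ := ih _ (by simp [Formula.depth]) φ rfl
    have h₂ := ih _ (by simp [Formula.depth]) ψ rfl
    simp only [Formula.eval, TV.and_eq_T, TV.and_eq_F, h₁, h₂, hT.and_mem, hT.neg_and_mem, and_self]
  | or φ ψ =>
    have h₁ := ih _ (by simp [Formula.depth]) φ rfl
    have h₂ := ih _ (by simp [Formula.depth]) ψ rfl
    simp only [Formula.eval, TV.or_eq_T, TV.or_eq_F, h₁, h₂, hT.or_mem, hT.neg_or_mem, and_self]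
  | all x φ =>
    have h := fun y => ih _ (by simp [Formula.depth, Formula.inst, Formula.depth_subst])
      (φ.inst x (.var y)) rfl
    simp only [Formula.eval, TV.all_eq_T, TV.all_eq_F]
    constructor
    · constructor
      · intro ha
        refine hT.all_mem_of_inst_mem φ.vars fun y hy => ?_
        rw [← (h y).1, ← inst φ x y hy]
        exact ha _
      · intro ha d
        obtain ⟨y, hy, rfl⟩ := hT.exists_classOf_eq d φ.vars
        rw [inst φ x y hy, (h y).1]
        exact hT.inst_mem_of_all_mem ha hy
    · constructor
      · rintro ⟨d, hd⟩
        obtain ⟨y, hy, rfl⟩ := hT.exists_classOf_eq d ({x} ∪ φ.vars ∪ (φ.isdef δ).vars)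
        simp only [Finset.mem_union, Finset.mem_singleton, not_or] at hy
        rw [inst φ x y hy.1.2, (h y).2] at hd
        exact hT.neg_all_mem_of_neg_inst_mem hd hy.1.1 hy.1.2 hy.2
      · intro ha
        obtain ⟨y, hy, hm⟩ := hT.exists_neg_inst_mem ha φ.vars
        exact ⟨hT.classOf y, by rwa [inst φ x y hy, (h y).2]⟩
  | ex x φ =>
    have h := fun y => ih _ (by simp [Formula.depth, Formula.inst, Formula.depth_subst])
      (φ.inst x (.var y)) rfl
    simp only [Formula.eval, TV.ex_eq_T, TV.ex_eq_F]
    constructor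
    · constructor
      · rintro ⟨d, hd⟩
        obtain ⟨y, hy, rfl⟩ := hT.exists_classOf_eq d φ.vars
        rw [inst φ x y hy, (h y).1] at hd
        exact hT.ex_mem_of_inst_mem hd hy
      · intro he
        obtain ⟨y, hy, hm⟩ := hT.witness x φ he φ.vars
        exact ⟨hT.classOf y, by rwa [inst φ x y hy, (h y).1]⟩
    · constructor
      · intro he
        refine hT.neg_ex_mem_of_neg_inst_mem φ.vars fun y hy => ?_
        rw [← (h y).2, ← inst φ x y hy]
        exact he _
      · intro he d
        obtain ⟨y, hy, rfl⟩ := hT.exists_classOf_eq d (φ.vars ∪ (φ.isdef δ).vars)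
        simp only [Finset.mem_union, not_or] at hy
        rw [inst φ x y hy.1, (h y).2]
        exact hT.neg_inst_mem_of_neg_ex_mem he hy.1 hy.2

/-- Evaluating ⌈f⌉ at classes amounts to asking whether ⌈f⌉ with representatives substituted lies in
T. The other conjuncts of ⌈f(…)⌉ are `verum`, so this says ⌈f(…)⌉ ∈ T, which is equivalent to f(…) =
z ∈ T for some z. -/
theorem canonical_modelsIsdef : hT.canonical.ModelsIsdef δ := by
  intro f ν
  let us : Fin (L.funcArity f) → Term L := fun i => .var (Quotient.out (s := hT.setoid) (ν i))
  have e : (δ.isdef f).eval hT.canonical ν =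
      ((δ.isdef f).renSubst (argSubst us)).eval hT.canonical hT.classOf := by
    rw [← Formula.evalPart_some, ← Formula.evalPart_some, Formula.evalPart_renSubst]
    refine (δ.isdef f).evalPart_congr fun n hn => ?_
    have := δ.freeVars_lt f n hn
    simp [argSubst, this, us, Term.evalPart, hT.classOf_out]
  have e' : ((δ.isdef f).renSubst (argSubst us)) ∈ T ↔ (Term.func f us).isdef δ ∈ T := by
    rw [Term.isdef, hT.conj_mem]
    simp only [List.mem_append, List.mem_ofFn, List.mem_singleton]
    constructor
    · rintro h φ (⟨i, rfl⟩ | rfl)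
      · exact hT.verum_mem
      · exact h
    · exact fun h => h _ (.inr rfl)
  rw [e, (hT.eval_canonical _).1, e']
  constructor
  · intro h
    obtain ⟨z, -, hz⟩ := hT.exists_eq_var_mem h ∅
    exact ⟨z, hz⟩
  · rintro ⟨z, hz⟩
    exact hT.mem_of_proves (.eqLeft (.of_mem hz))

theorem canonical_isModel : IsModel δ T hT.canonical hT.classOf :=
  ⟨hT.canonical_modelsIsdef, fun φ hφ => (hT.eval_canonical φ).1.2 hφ⟩

end IsHenkin

/-! ### Models of consistent sets that leave infinitely many variables unused -/

theorem exists_isModel_of_infinite {Γ : Set (Formula L)} (hΓ : ¬ Proves δ Γ .falsum)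
    (hinf : {y | ∀ φ ∈ Γ, y ∉ φ.vars}.Infinite) :
    ∃ (M : Structure L) (ν : ℕ → M.D), IsModel δ Γ M ν := by
  obtain ⟨T, hΓT, hT⟩ := exists_isHenkin hΓ hinf
  exact ⟨_, _, hT.canonical_isModel.1, fun φ hφ => hT.canonical_isModel.2 φ (hΓT hφ)⟩

theorem exists_isModel_of_finite {Γ : Set (Formula L)} (hΓ : ¬ Proves δ Γ .falsum)
    (hfin : Γ.Finite) : ∃ (M : Structure L) (ν : ℕ → M.D), IsModel δ Γ M ν := by
  refine exists_isModel_of_infinite hΓ ?_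
  have : (⋃ φ ∈ Γ, (φ.vars : Set ℕ)).Finite := hfin.biUnion fun φ _ => φ.vars.finite_toSet
  refine this.infinite_compl.mono fun y (hy : ¬ _) φ hφ hyφ => hy ?_
  exact Set.mem_biUnion (t := fun φ : Formula L => (φ.vars : Set ℕ)) hφ hyφ

/-! ### Renaming all variables -/

/-- Renaming of all variable symbols, free or bound, in a formula. -/
def Formula.rename (ρ : ℕ → ℕ) : Formula L → Formula L
  | .falsum => .falsum
  | .verum => .verum
  | .eq t₁ t₂ => .eq (t₁.subst fun n => .var (ρ n)) (t₂.subst fun n => .var (ρ n))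
  | .rel R ts => .rel R fun i => (ts i).subst fun n => .var (ρ n)
  | .neg φ => .neg (φ.rename ρ)
  | .and φ ψ => .and (φ.rename ρ) (ψ.rename ρ)
  | .or φ ψ => .or (φ.rename ρ) (ψ.rename ρ)
  | .all x φ => .all (ρ x) (φ.rename ρ)
  | .ex x φ => .ex (ρ x) (φ.rename ρ)

theorem Term.eval_subst_var {M : Structure L} (ρ : ℕ → ℕ) (ν : ℕ → M.D) (t : Term L) :
    (t.subst fun n => .var (ρ n)).eval M ν = t.eval M fun n => ν (ρ n) := by
  rw [← evalPart_some, evalPart_subst, ← evalPart_some]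
  rfl

theorem Formula.eval_rename {M : Structure L} {ρ : ℕ → ℕ} (hρ : Function.Injective ρ)
    (ν : ℕ → M.D) (φ : Formula L) : (φ.rename ρ).eval M ν = φ.eval M fun n => ν (ρ n) := by
  have upd : ∀ (ν : ℕ → M.D) (x : ℕ) (d : M.D), (fun n => Function.update ν (ρ x) d (ρ n)) =
      Function.update (fun n => ν (ρ n)) x d :=
    fun ν x d => Function.update_comp_eq_of_injective ν hρ x d
  induction φ generalizing ν with
  | falsum => rfl
  | verum => rfl
  | eq t₁ t₂ => simp only [rename, eval, Term.eval_subst_var]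
  | rel R ts => simp only [rename, eval, Term.eval_subst_var]
  | neg φ ih => simp only [rename, eval, ih]
  | and φ ψ ih₁ ih₂ => simp only [rename, eval, ih₁, ih₂]
  | or φ ψ ih₁ ih₂ => simp only [rename, eval, ih₁, ih₂]
  | all x φ ih => simp only [rename, eval, ih, upd]
  | ex x φ ih => simp only [rename, eval, ih, upd]

theorem Term.mem_range_of_mem_vars_subst_var {ρ : ℕ → ℕ} {t : Term L} {n : ℕ}
    (h : n ∈ (t.subst fun n => .var (ρ n)).vars) : n ∈ Set.range ρ := by
  obtain ⟨m, -, hm⟩ := t.exists_of_mem_vars_subst h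
  exact ⟨m, (Finset.mem_singleton.1 hm).symm⟩

theorem Formula.mem_range_of_mem_vars_rename {ρ : ℕ → ℕ} {φ : Formula L} {n : ℕ}
    (h : n ∈ (φ.rename ρ).vars) : n ∈ Set.range ρ := by
  induction φ with
  | falsum => simp [rename, vars] at h
  | verum => simp [rename, vars] at h
  | eq t₁ t₂ =>
    exact (Finset.mem_union.1 h).elim Term.mem_range_of_mem_vars_subst_var
      Term.mem_range_of_mem_vars_subst_var
  | rel R ts =>
    obtain ⟨i, -, hi⟩ := Finset.mem_biUnion.1 h
    exact Term.mem_range_of_mem_vars_subst_var hi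
  | neg φ ih => exact ih h
  | and φ ψ ih₁ ih₂ => exact (Finset.mem_union.1 h).elim ih₁ ih₂
  | or φ ψ ih₁ ih₂ => exact (Finset.mem_union.1 h).elim ih₁ ih₂
  | all x φ ih => exact (Finset.mem_insert.1 h).elim (fun h => ⟨x, h.symm⟩) ih
  | ex x φ ih => exact (Finset.mem_insert.1 h).elim (fun h => ⟨x, h.symm⟩) ih

/-! ### Completeness -/

theorem exists_isModel {Γ : Set (Formula L)} (hΓ : ¬ Proves δ Γ .falsum) :
    ∃ (M : Structure L) (ν : ℕ → M.D), IsModel δ Γ M ν := by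
  let ρ : ℕ → ℕ := fun n => 2 * n
  have hρ : Function.Injective ρ := fun a b h => by simp only [ρ] at h; omega
  have hcons : ¬ Proves δ (Formula.rename ρ '' Γ) .falsum := by
    intro h
    obtain ⟨Δ, hs, hf, h⟩ := h.exists_finite
    obtain ⟨Γ₀, hΓ₀, hf₀, h⟩ := Set.exists_subset_image_finite_and
      (p := fun Δ => Proves δ Δ .falsum).1 ⟨Δ, hs, hf, h⟩
    obtain ⟨M, ν, hM⟩ := exists_isModel_of_finite (fun h => hΓ (h.mono hΓ₀)) hf₀
    -- Halving the index undoes the renaming, so this assignment satisfies the renamed formulas.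
    have := h.sound M (fun n => ν (n / 2)) ⟨hM.1, ?_⟩
    · simp [Formula.eval] at this
    · rintro _ ⟨φ, hφ, rfl⟩
      rw [Formula.eval_rename hρ]
      simpa [ρ] using hM.2 φ hφ
  obtain ⟨M, ν, hM⟩ := exists_isModel_of_infinite hcons (by
    -- The odd variables do not occur in the renamed set.
    refine Set.infinite_of_injective_forall_mem (f := fun n : ℕ => 2 * n + 1)
      (fun a b h => by simp only at h; omega) ?_
    rintro n _ ⟨φ, -, rfl⟩ hn
    obtain ⟨m, hm⟩ := Formula.mem_range_of_mem_vars_rename hn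
    simp only [ρ] at hm
    omega)
  refine ⟨M, fun n => ν (ρ n), hM.1, fun φ hφ => ?_⟩
  rw [← Formula.eval_rename hρ]
  exact hM.2 _ ⟨φ, hφ, rfl⟩

theorem Entails.proves {Γ : Set (Formula L)} {φ : Formula L} (h : Entails δ Γ φ) :
    Proves δ Γ φ := by
  -- A formula ψ that is never true together with φ is inconsistent with Γ, since Γ entails φ. This
  -- covers both ¬φ and ¬⌈φ⌉.
  have key : ∀ ψ : Formula L, (∀ (M : Structure L) (ν : ℕ → M.D), M.ModelsIsdef δ →
      φ.eval M ν = .T → ψ.eval M ν ≠ .T) → Proves δ (Γ ∪ {ψ}) φ := by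
    intro ψ hψ
    by_contra hn
    obtain ⟨M, ν, hM⟩ := exists_isModel fun h => hn (Proves.exFalso h)
    exact hψ M ν hM.1 (h M ν ⟨hM.1, fun θ hθ => hM.2 θ (.inl hθ)⟩) (hM.2 ψ (.inr rfl))
  refine .trichotomy .last (key _ ?_) (key _ ?_)
  · intro M ν _ hφ
    simp [Formula.eval, hφ, TV.neg]
  · intro M ν hM hφ
    simp [Formula.eval, (φ.eval_isdef hM ν).1.2 (.inl hφ), TV.neg]

end PartialLogic

theorem theoremT (L : PartialLogic.Signature) (δ : PartialLogic.IsdefFormulas L) :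
    (∀ Γ : Set (PartialLogic.Formula L), ¬ PartialLogic.Proves δ Γ .falsum →
      ∃ (M : PartialLogic.Structure L) (ν : ℕ → M.D), PartialLogic.IsModel δ Γ M ν) ∧
    (∀ (Γ : Set (PartialLogic.Formula L)) (φ : PartialLogic.Formula L),
      PartialLogic.Entails δ Γ φ → PartialLogic.Proves δ Γ φ) :=
  ⟨fun _ => PartialLogic.exists_isModel, fun _ _ => PartialLogic.Entails.proves⟩
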